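/- Let $m\ge 2$ and $d\ge 1$, write points of $\mathbb R^{md}$ as $\vec u=(u^1,\dots,u^m)$ with $u^j\in\mathbb R^d$, and let $\nu$ be surface measure on the unit sphere $\mathbb S^{md-1}=\{\vec u\in\mathbb R^{md}:|u^1|^2+\cdots+|u^m|^2=1\}$. Let $\frac{d+1}{d}<p\le 2$ and $\frac1p+\frac1{p'}=1$. Then there is a constant $C=C(m,d,p)<\infty$ such that for all $f_1,\dots,f_m\in L^p(\mathbb R^d)$ the integral $$B_\nu(f_1,\dots,f_m)(x)=\int_{\mathbb R^{md}} f_1(x-u^1)\cdots f_m(x-u^m)\,d\nu(\vec u)$$ converges absolutely for almost every $x\in\mathbb R^d$, the function $B_\nu(f_1,\dots,f_m)$ belongs to $L^{p'}(\mathbb R^d)$, and $$\|B_\nu(f_1,\dots,f_m)\|_{L^{p'}(\mathbb R^d)}\le C\prod_{j=1}^m\|f_j\|_{L^p(\mathbb R^d)}.$$ -/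

import Mathlib

open MeasureTheory

noncomputable section

/-- The block `u^j ∈ ℝ^d` of a point `u = (u^1, …, u^m) ∈ ℝ^{md}`; the coordinates of `ℝ^{md}`
are indexed by the pairs `(j, i)` with `j < m` and `i < d`. -/
def block {m d : ℕ} (j : Fin m) (u : EuclideanSpace ℝ (Fin m × Fin d)) :
    EuclideanSpace ℝ (Fin d) :=
  WithLp.toLp 2 (fun i => u (j, i))

/-- The unit sphere of `ℝ^{md}` is the set `|u^1|² + ⋯ + |u^m|² = 1`. -/
theorem mem_unitSphere_iff_sum_block {m d : ℕ} (u : EuclideanSpace ℝ (Fin m × Fin d)) :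
    u ∈ Metric.sphere (0 : EuclideanSpace ℝ (Fin m × Fin d)) 1 ↔
      ∑ j, ‖block j u‖ ^ 2 = 1 := by
  have h : ∑ j, ‖block j u‖ ^ 2 = ‖u‖ ^ 2 := by
    simp only [EuclideanSpace.norm_sq_eq, block]
    rw [Fintype.sum_prod_type]
  rw [h, mem_sphere_zero_iff_norm]
  constructor
  · intro h1
    rw [h1, one_pow]
  · intro h1
    nlinarith [norm_nonneg u]

/-- Surface measure on the unit sphere of `ℝ^{md}`, as a measure on `ℝ^{md}`. Its value on a Borel
set `A` is `md` times the Lebesgue measure of the cone `{r • u : 0 < r < 1, u ∈ A, ‖u‖ = 1}`. -/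
def sphereSurfaceMeasure (m d : ℕ) : Measure (EuclideanSpace ℝ (Fin m × Fin d)) :=
  (volume : Measure (EuclideanSpace ℝ (Fin m × Fin d))).toSphere.map Subtype.val

/-- The `m`-linear convolution operator with a measure `ν` on `ℝ^{md}`:
`B_ν(f_1, …, f_m)(x) = ∫ f_1(x - u^1) ⋯ f_m(x - u^m) dν(u)`. -/
def multilinearAverage {m d : ℕ} (ν : Measure (EuclideanSpace ℝ (Fin m × Fin d)))
    (f : Fin m → EuclideanSpace ℝ (Fin d) → ℂ) (x : EuclideanSpace ℝ (Fin d)) : ℂ :=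
  ∫ u, ∏ j, f j (x - block j u) ∂ν

end

/-! Write m = n + 1. Testing the average against a function h gives the (m+1)-linear form Λ(h, f_1,
…, f_m) = ∫∫ h(x) ∏ f_j(x - u^j) dν(u) dx, and by duality it suffices to bound Λ by the product of
all m + 1 norms in L^p. The assumption on p forces d ≥ 2.

Translating the tensor product ∏ f_j by w ∈ ℝ^{md} turns Λ into a function Φ(w) with Φ(0) = Λ, whose
Fourier transform is ĥ(∑ ξ^j) ν̂(ξ) ∏ f̂_j(-ξ^j) (`fourier_formTranslate`). By inversion Λ = ∫ Φ̂,
and this integral is split at frequency L by a multiplier 1 - b that is a combination of Gaussians.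
At low frequency ν is smoothed at scale 1/L; the smoothed measure has density O(L) because the
sphere has codimension one, so this part is O(L) times the product of the L¹ norms. At high
frequency the decay |ν̂(ξ)|² = O(|ξ|^{-(md-1)}), Cauchy–Schwarz and Plancherel give O(L^{(1-d)/2})
times the product of the L² norms. Both parts are combined in `exists_enorm_formTranslate_zero_le`.

For functions with values in [0, 1] the squared L² norm is at most the L¹ norm. With A the product
of the integrals, optimising L gives Λ = O(A^{d/(d+1)}), a restricted-type bound at the exponent
(d+1)/d (`exists_sphereForm_restricted_le`). For p > (d+1)/d a dyadic decomposition in height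
upgrades this to a strong bound for functions supported in sets of bounded measure
(`exists_sphereForm_local_le`). Since |u^j| ≤ 1, the form is local at unit scale, and Hölder's
inequality sums the local bounds because (m+1)/p ≥ 1 (`exists_sphereForm_le`). Duality and Fatou's
lemma then reach all of L^p.

The decay of ν̂ comes from rotation invariance: along an axis ν̂ solves a Bessel-type equation, for
which an energy is almost conserved. -/

noncomputable section

set_option linter.unusedSectionVars false

/-! ### Gaussians, correlations and Plancherel's inequality. -/

section FourierToolkit

open FourierTransform Filter Topology
open scoped RealInnerProductSpace

variable {V : Type*} [NormedAddCommGroup V] [InnerProductSpace ℝ V] [FiniteDimensional ℝ V]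
  [MeasurableSpace V] [BorelSpace V]

/-- The Gaussian probability density whose Fourier transform is `ξ ↦ exp (-τ * ‖ξ‖ ^ 2)`. -/
def gaussDensity (τ : ℝ) (w : V) : ℝ :=
  (Real.pi / τ) ^ ((Module.finrank ℝ V : ℝ) / 2) * Real.exp (-(Real.pi ^ 2 / τ) * ‖w‖ ^ 2)

theorem gaussDensity_nonneg {τ : ℝ} (hτ : 0 < τ) (w : V) : 0 ≤ gaussDensity τ w := by
  unfold gaussDensity; positivity

theorem continuous_gaussDensity (τ : ℝ) : Continuous (gaussDensity (V := V) τ) := by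
  unfold gaussDensity; fun_prop

theorem integral_gaussDensity {τ : ℝ} (hτ : 0 < τ) : ∫ w : V, gaussDensity τ w = 1 := by
  have hp := Real.pi_pos
  unfold gaussDensity
  rw [integral_const_mul, GaussianFourier.integral_rexp_neg_mul_sq_norm (by positivity),
    ← Real.mul_rpow (by positivity) (by positivity)]
  have : Real.pi / τ * (Real.pi / (Real.pi ^ 2 / τ)) = 1 := by field_simp
  rw [this, Real.one_rpow]

theorem integrable_gaussDensity {τ : ℝ} (hτ : 0 < τ) :
    Integrable (gaussDensity (V := V) τ) := by
  by_contra h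
  have := integral_gaussDensity (V := V) hτ
  rw [integral_undef h] at this
  exact zero_ne_one this

theorem lintegral_gaussDensity {τ : ℝ} (hτ : 0 < τ) :
    ∫⁻ w : V, ENNReal.ofReal (gaussDensity τ w) = 1 := by
  rw [← ofReal_integral_eq_lintegral_ofReal (integrable_gaussDensity hτ)
    (ae_of_all _ fun w => gaussDensity_nonneg hτ w), integral_gaussDensity hτ, ENNReal.ofReal_one]

/-- The Fourier transform is moved from the Gaussian exp(-τ‖ξ‖²) onto Φ by Fubini. It serves for
Plancherel's inequality and, in the main argument, to rewrite a Gaussian frequency cutoff as an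
average of Φ against a positive kernel. -/
theorem integral_gaussDensity_mul {τ : ℝ} (hτ : 0 < τ) {Φ : V → ℂ} (hΦ : Integrable Φ) :
    ∫ w, (gaussDensity τ w : ℂ) * Φ w = ∫ ξ, (Real.exp (-τ * ‖ξ‖ ^ 2) : ℂ) * 𝓕 Φ ξ := by
  have hτ' : 0 < (τ : ℂ).re := by simpa
  have J : Integrable (fun w : V => Complex.exp (-(τ : ℂ) * ‖w‖ ^ 2)) := by
    simpa using GaussianFourier.integrable_cexp_neg_mul_sq_norm_add hτ' 0 (0 : V)
  have key := VectorFourier.integral_fourierIntegral_smul_eq_flip (L := innerₗ V)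
      Real.continuous_fourierChar continuous_inner J hΦ
  have e1 : ∀ w : V, VectorFourier.fourierIntegral Real.fourierChar volume (innerₗ V)
      (fun w : V => Complex.exp (-(τ : ℂ) * ‖w‖ ^ 2)) w = (gaussDensity τ w : ℂ) := by
    intro w
    refine (fourier_gaussian_innerProductSpace hτ' w).trans ?_
    unfold gaussDensity
    push_cast
    rw [Complex.ofReal_cpow (by positivity)]
    push_cast
    congr 2
    ring
  have e2 : ∀ ξ : V, VectorFourier.fourierIntegral Real.fourierChar volume (innerₗ V).flip Φ ξ
      = 𝓕 Φ ξ := by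
    intro ξ
    rw [flip_innerₗ]
    rfl
  simp only [e1, e2, smul_eq_mul] at key
  rw [key]
  congr with ξ
  push_cast
  rfl

section Correlation

variable {X : Type*} [MeasurableSpace X] {μ : Measure X} [SFinite μ] {a : X → ℂ} {T : X → V}
  {F : V → ℂ}

/-- The correlation `w ↦ ∫ a p * F (T p - w) dμ p`. -/
def correlation (μ : Measure X) (a : X → ℂ) (T : X → V) (F : V → ℂ) (w : V) : ℂ :=
  ∫ p, a p * F (T p - w) ∂μ

theorem continuous_correlation (ha : Integrable a μ) (hT : Measurable T) (hF : Continuous F)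
    {M : ℝ} (hM : ∀ v, ‖F v‖ ≤ M) : Continuous (correlation μ a T F) := by
  refine continuous_of_dominated (bound := fun p => ‖a p‖ * M) ?_ ?_ (ha.norm.mul_const M) ?_
  · intro w
    exact ha.1.mul (hF.measurable.comp (hT.sub_const w)).aestronglyMeasurable
  · intro w
    filter_upwards with p
    rw [norm_mul]
    gcongr
    exact hM _
  · filter_upwards with p
    fun_prop

theorem integrable_correlation_integrand (ha : Integrable a μ) (hT : Measurable T)
    (hF : Continuous F) (hFi : Integrable F) :
    Integrable (fun q : X × V => a q.1 * F (T q.1 - q.2)) (μ.prod volume) := by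
  rw [integrable_prod_iff]
  · refine ⟨ae_of_all _ fun p => (hFi.comp_sub_left (T p)).const_mul (a p), ?_⟩
    simp only [norm_mul, integral_const_mul]
    refine (ha.norm.mul_const (∫ v, ‖F v‖)).congr (ae_of_all _ fun p => ?_)
    simp only
    rw [integral_sub_left_eq_self (fun v => ‖F v‖) volume (T p)]
  · exact ha.1.comp_fst.mul (hF.measurable.comp
      ((hT.comp measurable_fst).sub measurable_snd)).aestronglyMeasurable

theorem integrable_correlation (ha : Integrable a μ) (hT : Measurable T)
    (hF : Continuous F) (hFi : Integrable F) : Integrable (correlation μ a T F) :=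
  (integrable_correlation_integrand ha hT hF hFi).integral_prod_right

/-- Fubini and the substitution w ↦ T p - w split the phase into a factor in p and a factor in w;
the reflection is the source of -ξ. Both the autocorrelation in Plancherel's inequality and the
translated form are instances. -/
theorem fourier_correlation (ha : Integrable a μ) (hT : Measurable T)
    (hF : Continuous F) (hFi : Integrable F) (ξ : V) :
    𝓕 (correlation μ a T F) ξ =
      (∫ p, a p * (Real.fourierChar (-⟪T p, ξ⟫) : ℂ) ∂μ) * 𝓕 F (-ξ) := by
  have hint := integrable_correlation_integrand ha hT hF hFi
  have hint2 : Integrable (fun q : X × V =>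
      (Real.fourierChar (-⟪q.2, ξ⟫) : ℂ) * (a q.1 * F (T q.1 - q.2))) (μ.prod volume) := by
    refine hint.bdd_mul (c := 1) ?_ ?_
    · exact Continuous.aestronglyMeasurable (by fun_prop) |>.comp_snd
        (f := fun w : V => (Real.fourierChar (-⟪w, ξ⟫) : ℂ))
    · exact ae_of_all _ fun q => (Circle.norm_coe _).le
  have hint3 : Integrable (Function.uncurry fun (w : V) (p : X) =>
      (Real.fourierChar (-⟪w, ξ⟫) : ℂ) * (a p * F (T p - w))) (volume.prod μ) := hint2.swap
  rw [Real.fourier_eq]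
  simp only [correlation, Circle.smul_def, smul_eq_mul]
  simp_rw [← integral_const_mul]
  rw [integral_integral_swap hint3, ← integral_mul_const]
  congr 1 with p
  rw [Real.fourier_eq, ← integral_sub_left_eq_self _ volume (T p), mul_assoc, ← integral_const_mul,
    ← integral_const_mul]
  congr 1 with w
  simp only [Circle.smul_def, smul_eq_mul, sub_sub_cancel]
  have hch : (Real.fourierChar (-⟪T p - w, ξ⟫) : ℂ) =
      (Real.fourierChar (-⟪T p, ξ⟫) : ℂ) * (Real.fourierChar (-⟪w, -ξ⟫) : ℂ) := by
    rw [← Circle.coe_mul, ← AddChar.map_add_eq_mul]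
    congr 2
    simp only [inner_sub_left, inner_neg_right]
    ring
  linear_combination (a p * F w) * hch

end Correlation

/-- **Plancherel's inequality** for continuous functions with compact support. -/
theorem lintegral_enorm_fourier_sq_le {f : V → ℝ} (hf : Continuous f) (hc : HasCompactSupport f) :
    ∫⁻ ξ, ‖𝓕 (fun v => (f v : ℂ)) ξ‖ₑ ^ 2 ≤ ENNReal.ofReal (∫ v, f v ^ 2) := by
  set F : V → ℂ := fun v => (f v : ℂ) with hFdef
  have hF : Continuous F := by fun_prop
  have hFi : Integrable F := (hf.integrable_of_hasCompactSupport hc).ofReal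
  have hf2 : Integrable (fun v => f v ^ 2) := by
    refine (by fun_prop : Continuous _).integrable_of_hasCompactSupport ?_
    exact hc.comp_left (g := fun x : ℝ => x ^ 2) (by simp)
  -- The autocorrelation of f: its transform is |𝓕 F|², and 2ab ≤ a² + b² bounds it everywhere by
  -- the squared L² norm of f.
  set Φ := correlation volume F id F
  have hΦi : Integrable Φ := integrable_correlation hFi measurable_id hF hFi
  have hΦF : ∀ ξ, 𝓕 Φ ξ = ((‖𝓕 F ξ‖ ^ 2 : ℝ) : ℂ) := by
    intro ξ
    rw [fourier_correlation hFi measurable_id hF hFi]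
    have e1 : (∫ p, F p * (Real.fourierChar (-⟪id p, ξ⟫) : ℂ)) = 𝓕 F ξ := by
      rw [Real.fourier_eq]
      congr 1 with p
      simp [Circle.smul_def, mul_comm]
    have e2 : 𝓕 F (-ξ) = (starRingEnd ℂ) (𝓕 F ξ) := by
      rw [Real.fourier_eq, Real.fourier_eq, ← integral_conj]
      congr 1 with p
      simp [Circle.smul_def, F, AddChar.map_neg_eq_inv]
    rw [e1, e2, Complex.mul_conj, Complex.normSq_eq_norm_sq]
  have hbound : ∀ w, ‖Φ w‖ ≤ ∫ v, f v ^ 2 := by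
    intro w
    refine (norm_integral_le_integral_norm _).trans ?_
    have hs : Integrable (fun v => f (v - w) ^ 2) := hf2.comp_sub_right w
    calc ∫ p, ‖F p * F (id p - w)‖ ≤ ∫ p, (f p ^ 2 + f (p - w) ^ 2) / 2 := by
          refine integral_mono_of_nonneg (ae_of_all _ fun p => norm_nonneg _)
            ((hf2.add hs).div_const 2) (ae_of_all _ fun p => ?_)
          simp only [F, id, norm_mul, Complex.norm_real, Real.norm_eq_abs]
          rw [← sq_abs (f p), ← sq_abs (f (p - w))]
          nlinarith [sq_nonneg (|f p| - |f (p - w)|)]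
      _ = ∫ v, f v ^ 2 := by
          rw [integral_div, integral_add hf2 hs,
            integral_sub_right_eq_self (fun v => f v ^ 2) w]
          ring
  have hFc : Continuous (𝓕 F) :=
    VectorFourier.fourierIntegral_continuous Real.continuous_fourierChar
      (by exact continuous_inner) hFi
  -- With a Gaussian weight the integral of |𝓕 F|² becomes a Gaussian average of Φ, hence is at most
  -- sup |Φ|. The weights tend to 1 and Fatou's lemma removes them.
  have hstep : ∀ n : ℕ, ∫⁻ ξ, ENNReal.ofReal (Real.exp (-(1 / ((n : ℝ) + 1)) * ‖ξ‖ ^ 2)) *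
      ‖𝓕 F ξ‖ₑ ^ 2 ≤ ENNReal.ofReal (∫ v, f v ^ 2) := by
    intro n
    have hτ : (0 : ℝ) < 1 / ((n : ℝ) + 1) := by positivity
    set τ := 1 / ((n : ℝ) + 1)
    have key := integral_gaussDensity_mul hτ hΦi
    have hle : ‖∫ w, (gaussDensity τ w : ℂ) * Φ w‖ ≤ ∫ v, f v ^ 2 := by
      refine (norm_integral_le_integral_norm _).trans ?_
      calc ∫ w, ‖(gaussDensity τ w : ℂ) * Φ w‖
          ≤ ∫ w : V, gaussDensity τ w * ∫ v, f v ^ 2 := by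
            refine integral_mono_of_nonneg (ae_of_all _ fun p => norm_nonneg _)
              ((integrable_gaussDensity hτ).mul_const _) (ae_of_all _ fun w => ?_)
            simp only [norm_mul, Complex.norm_real, Real.norm_eq_abs,
              abs_of_nonneg (gaussDensity_nonneg hτ w)]
            exact mul_le_mul_of_nonneg_left (hbound w) (gaussDensity_nonneg hτ w)
        _ = _ := by rw [integral_mul_const, integral_gaussDensity hτ, one_mul]
    have hgi : Integrable (fun ξ : V => Real.exp (-τ * ‖ξ‖ ^ 2)) := by
      have := (GaussianFourier.integrable_cexp_neg_mul_sq_norm_add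
        (b := (τ : ℂ)) (by simpa) 0 (0 : V)).norm
      refine this.congr (ae_of_all _ fun ξ => ?_)
      simp only [inner_zero_left, Complex.ofReal_zero, mul_zero, add_zero, Complex.norm_exp]
      congr 1
      norm_cast
    have hbd : ∀ ξ, ‖𝓕 F ξ‖ ≤ ∫ v, ‖F v‖ := fun ξ =>
      VectorFourier.norm_fourierIntegral_le_integral_norm _ _ _ _ _
    have hii : Integrable (fun ξ : V => Real.exp (-τ * ‖ξ‖ ^ 2) * ‖𝓕 F ξ‖ ^ 2) := by
      refine hgi.mul_bdd (c := (∫ v, ‖F v‖) ^ 2) (by fun_prop) (ae_of_all _ fun ξ => ?_)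
      rw [norm_pow, norm_norm]
      gcongr
      exact hbd ξ
    have e : ∫ ξ, (Real.exp (-τ * ‖ξ‖ ^ 2) : ℂ) * 𝓕 Φ ξ =
        ((∫ ξ, Real.exp (-τ * ‖ξ‖ ^ 2) * ‖𝓕 F ξ‖ ^ 2 : ℝ) : ℂ) := by
      rw [← integral_complex_ofReal]
      congr 1 with ξ
      rw [hΦF]; push_cast; rfl
    rw [key, e, Complex.norm_real, Real.norm_eq_abs, abs_of_nonneg (by positivity)] at hle
    rw [show (∫⁻ ξ, ENNReal.ofReal (Real.exp (-τ * ‖ξ‖ ^ 2)) * ‖𝓕 F ξ‖ₑ ^ 2) =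
      ∫⁻ ξ, ENNReal.ofReal (Real.exp (-τ * ‖ξ‖ ^ 2) * ‖𝓕 F ξ‖ ^ 2) from ?_,
      ← ofReal_integral_eq_lintegral_ofReal hii (ae_of_all _ fun ξ => by positivity)]
    · exact ENNReal.ofReal_le_ofReal hle
    · congr 1 with ξ
      rw [ENNReal.ofReal_mul (by positivity), ENNReal.ofReal_pow (norm_nonneg _), ofReal_norm]
  have hlim : ∀ ξ : V, Tendsto (fun n : ℕ => ENNReal.ofReal
      (Real.exp (-(1 / ((n : ℝ) + 1)) * ‖ξ‖ ^ 2)) * ‖𝓕 F ξ‖ₑ ^ 2) atTop (𝓝 (‖𝓕 F ξ‖ₑ ^ 2)) := by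
    intro ξ
    have h1 : Tendsto (fun n : ℕ => Real.exp (-(1 / ((n : ℝ) + 1)) * ‖ξ‖ ^ 2)) atTop (𝓝 1) := by
      have := (tendsto_one_div_add_atTop_nhds_zero_nat (𝕜 := ℝ)).neg.mul_const (‖ξ‖ ^ 2)
      have h0 := (Real.continuous_exp.tendsto _).comp this
      rw [neg_zero, zero_mul, Real.exp_zero] at h0
      exact h0
    have h2 := ENNReal.tendsto_ofReal h1
    have h3 := ENNReal.Tendsto.mul_const (b := ‖𝓕 F ξ‖ₑ ^ 2) h2 (Or.inr (by simp))
    simpa using h3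
  calc ∫⁻ ξ, ‖𝓕 F ξ‖ₑ ^ 2
      = ∫⁻ ξ, liminf (fun n : ℕ => ENNReal.ofReal
      (Real.exp (-(1 / ((n : ℝ) + 1)) * ‖ξ‖ ^ 2)) * ‖𝓕 F ξ‖ₑ ^ 2) atTop := by
        congr 1 with ξ
        exact (hlim ξ).liminf_eq.symm
    _ ≤ liminf (fun n : ℕ => ∫⁻ ξ, ENNReal.ofReal
      (Real.exp (-(1 / ((n : ℝ) + 1)) * ‖ξ‖ ^ 2)) * ‖𝓕 F ξ‖ₑ ^ 2) atTop := by
        refine lintegral_liminf_le fun n => ?_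
        fun_prop
    _ ≤ liminf (fun n : ℕ => ENNReal.ofReal (∫ v, f v ^ 2)) atTop :=
        liminf_le_liminf (Eventually.of_forall hstep)
    _ = _ := by simp

end FourierToolkit

/-! ### Surface measure: isometry invariance, polar coordinates, Gaussian smoothing. -/

section UnitSphereMeasure

open Set Metric
open scoped RealInnerProductSpace Pointwise ENNReal

variable {V : Type*} [NormedAddCommGroup V] [InnerProductSpace ℝ V] [FiniteDimensional ℝ V]
  [MeasurableSpace V] [BorelSpace V]

variable (V) in
/-- Surface measure on the unit sphere, as a measure on the ambient space. -/
def unitSphereMeasure : Measure V := (volume : Measure V).toSphere.map Subtype.val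

instance : IsFiniteMeasure (unitSphereMeasure V) := by
  unfold unitSphereMeasure; infer_instance

theorem ae_norm_eq_one : ∀ᵐ u ∂(unitSphereMeasure V), ‖u‖ = 1 := by
  unfold unitSphereMeasure
  rw [ae_map_iff measurable_subtype_coe.aemeasurable
    (measurableSet_eq_fun measurable_norm measurable_const)]
  exact ae_of_all _ fun u => by simp

theorem unitSphereMeasure_apply {s : Set V} (hs : MeasurableSet s) :
    unitSphereMeasure V s =
      Module.finrank ℝ V * volume (Ioo (0 : ℝ) 1 • (sphere (0 : V) 1 ∩ s)) := by
  unfold unitSphereMeasure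
  rw [Measure.map_apply measurable_subtype_coe hs,
    Measure.toSphere_apply' _ (measurable_subtype_coe hs), Subtype.image_preimage_coe]

/-- A linear isometry commutes with forming the cone over a subset of the sphere and preserves
Lebesgue measure. -/
theorem measurePreserving_unitSphereMeasure (A : V ≃ₗᵢ[ℝ] V) :
    MeasurePreserving A (unitSphereMeasure V) (unitSphereMeasure V) := by
  refine ⟨A.continuous.measurable, ?_⟩
  ext s hs
  rw [Measure.map_apply A.continuous.measurable hs, unitSphereMeasure_apply hs,
    unitSphereMeasure_apply (A.continuous.measurable hs)]
  congr 1
  have : Ioo (0 : ℝ) 1 • (sphere (0 : V) 1 ∩ A ⁻¹' s) =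
      A ⁻¹' (Ioo (0 : ℝ) 1 • (sphere (0 : V) 1 ∩ s)) := by
    ext x
    simp only [Set.mem_smul, Set.mem_preimage, Set.mem_inter_iff, mem_sphere_zero_iff_norm]
    constructor
    · rintro ⟨r, hr, u, ⟨hu, hus⟩, rfl⟩
      exact ⟨r, hr, A u, ⟨by simpa using hu, hus⟩, by simp⟩
    · rintro ⟨r, hr, u, ⟨hu, hus⟩, h⟩
      exact ⟨r, hr, A.symm u, ⟨by simpa using hu, by simpa using hus⟩,
        A.injective (by simpa using h)⟩
  rw [this]
  exact A.measurePreserving.measure_preimage_equiv (f := A.toHomeomorph.toMeasurableEquiv) _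

theorem integral_comp_linearIsometryEquiv_unitSphere {G : Type*} [NormedAddCommGroup G]
    [NormedSpace ℝ G] (A : V ≃ₗᵢ[ℝ] V) (g : V → G) :
    ∫ u, g (A u) ∂(unitSphereMeasure V) = ∫ u, g u ∂(unitSphereMeasure V) :=
  (measurePreserving_unitSphereMeasure A).integral_comp A.toHomeomorph.measurableEmbedding g

/-- Polar coordinates, where the Jacobian r^(dim - 1) is at least 1 for r ≥ 1 and may be dropped. -/
theorem setLIntegral_lintegral_unitSphere_le [Nontrivial V] {g : V → ℝ≥0∞} (hg : Measurable g)
    {s : Set ℝ} (hs : MeasurableSet s) (hs1 : ∀ r ∈ s, 1 ≤ r) :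
    ∫⁻ r in s, ∫⁻ u, g (r • u) ∂(unitSphereMeasure V) ≤ ∫⁻ w, g w := by
  have hmp := (volume : Measure V).measurePreserving_homeomorphUnitSphereProd
  have hgm : Measurable fun q : ℝ × V => g (q.1 • q.2) :=
    hg.comp (measurable_fst.smul measurable_snd)
  have hG : Measurable fun r : ℝ => ∫⁻ u, g (r • u) ∂(unitSphereMeasure V) :=
    hgm.lintegral_prod_right'
  have hpolar : ∫⁻ w, g w = ∫⁻ r in Ioi (0 : ℝ), ENNReal.ofReal (r ^ (Module.finrank ℝ V - 1)) *
      ∫⁻ u, g (r • u) ∂(unitSphereMeasure V) := by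
    have hG' : Measurable fun p : sphere (0 : V) 1 × Ioi (0 : ℝ) => g ((p.2 : ℝ) • (p.1 : V)) :=
      hgm.comp (f := fun p : sphere (0 : V) 1 × Ioi (0 : ℝ) => ((p.2 : ℝ), (p.1 : V)))
        ((measurable_subtype_coe.comp measurable_snd).prodMk
          (measurable_subtype_coe.comp measurable_fst))
    calc ∫⁻ w, g w = ∫⁻ w in ({0}ᶜ : Set V), g w := by
          rw [restrict_compl_singleton]
      _ = ∫⁻ w : ({0}ᶜ : Set V), g w ∂((volume : Measure V).comap (↑)) :=
          (lintegral_subtype_comap (measurableSet_singleton _).compl g).symm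
      _ = ∫⁻ p : sphere (0 : V) 1 × Ioi (0 : ℝ), g ((p.2 : ℝ) • (p.1 : V))
            ∂((volume : Measure V).toSphere.prod
              (Measure.volumeIoiPow (Module.finrank ℝ V - 1))) := by
          rw [← hmp.lintegral_comp hG']
          refine lintegral_congr fun w => ?_
          congr 1
          simp only [homeomorphUnitSphereProd_apply_fst_coe, homeomorphUnitSphereProd_apply_snd_coe]
          rw [smul_inv_smul₀ (norm_ne_zero_iff.2 w.2)]
      _ = ∫⁻ r : Ioi (0 : ℝ), ∫⁻ u, g ((r : ℝ) • u) ∂(unitSphereMeasure V)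
            ∂(Measure.volumeIoiPow (Module.finrank ℝ V - 1)) := by
          rw [lintegral_prod_symm' _ hG']
          refine lintegral_congr fun r => ?_
          exact (lintegral_map (f := fun u : V => g ((r : ℝ) • u))
            (hg.comp (measurable_const_smul (r : ℝ))) measurable_subtype_coe).symm
      _ = _ := by
          refine (lintegral_withDensity_eq_lintegral_mul
            ((volume : Measure ℝ).comap (Subtype.val : Ioi (0 : ℝ) → ℝ))
            (f := fun r : Ioi (0 : ℝ) => ENNReal.ofReal ((r : ℝ) ^ (Module.finrank ℝ V - 1)))
            (by fun_prop) (hG.comp measurable_subtype_coe)).trans ?_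
          exact lintegral_subtype_comap measurableSet_Ioi
            (fun r : ℝ => ENNReal.ofReal (r ^ (Module.finrank ℝ V - 1)) *
              ∫⁻ u, g (r • u) ∂(unitSphereMeasure V))
  rw [hpolar]
  refine (setLIntegral_mono' hs fun r hr => ?_).trans
    (lintegral_mono_set (fun r hr => zero_lt_one.trans_le (hs1 r hr)))
  refine le_mul_of_one_le_left zero_le ?_
  rw [ENNReal.one_le_ofReal]
  exact one_le_pow₀ (hs1 r hr)

/-- The Gaussian has width of order √τ, so thickening the sphere radially by √τ changes its values
little. The thickened integral is at most the total mass of a Gaussian, which is 1, and dividing by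
the thickness gives K / √τ. -/
theorem exists_lintegral_gaussDensity_unitSphere_le [Nontrivial V] :
    ∃ K : ℝ, 0 ≤ K ∧ ∀ τ : ℝ, 0 < τ → ∀ v : V,
      ∫⁻ u, ENNReal.ofReal (gaussDensity τ (v - u)) ∂(unitSphereMeasure V) ≤
        ENNReal.ofReal (K / √τ) := by
  set K : ℝ := 2 ^ ((Module.finrank ℝ V : ℝ) / 2) * Real.exp (Real.pi ^ 2) with hK
  have hK0 : 0 ≤ K := by positivity
  refine ⟨K, hK0, fun τ hτ v => ?_⟩
  have hsτ : 0 < √τ := Real.sqrt_pos.2 hτ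
  -- Since ‖v - r u‖² ≤ 2‖v - u‖² + 2τ, passing to the Gaussian of parameter 2τ costs exp(π²) in the
  -- exponential and 2^(dim/2) in the normalisation; their product is K.
  have hpt : ∀ u : V, ‖u‖ = 1 → ∀ r ∈ Ioc 1 (1 + √τ),
      gaussDensity τ (v - u) ≤ K * gaussDensity (2 * τ) (v - r • u) := by
    intro u hu r hr
    have h1 : ‖v - r • u‖ ≤ ‖v - u‖ + √τ := by
      have : v - r • u = (v - u) - (r - 1) • u := by rw [sub_smul, one_smul]; abel
      rw [this]
      refine (norm_sub_le _ _).trans ?_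
      rw [norm_smul, hu, mul_one, Real.norm_eq_abs, abs_of_pos (by linarith [hr.1])]
      linarith [hr.2]
    have h2 : ‖v - r • u‖ ^ 2 ≤ 2 * ‖v - u‖ ^ 2 + 2 * τ := by
      have := Real.sq_sqrt hτ.le
      nlinarith [sq_nonneg (‖v - u‖ - √τ), norm_nonneg (v - r • u)]
    have h3 : (Real.pi / τ) = 2 * (Real.pi / (2 * τ)) := by field_simp
    unfold gaussDensity
    rw [h3, Real.mul_rpow (by norm_num) (by positivity), hK]
    have h4 : Real.exp (-(Real.pi ^ 2 / τ) * ‖v - u‖ ^ 2) ≤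
        Real.exp (Real.pi ^ 2) * Real.exp (-(Real.pi ^ 2 / (2 * τ)) * ‖v - r • u‖ ^ 2) := by
      rw [← Real.exp_add]
      apply Real.exp_le_exp.2
      have : Real.pi ^ 2 + -(Real.pi ^ 2 / (2 * τ)) * ‖v - r • u‖ ^ 2 -
        (-(Real.pi ^ 2 / τ) * ‖v - u‖ ^ 2) =
          Real.pi ^ 2 / (2 * τ) * (2 * ‖v - u‖ ^ 2 + 2 * τ - ‖v - r • u‖ ^ 2) := by
        field_simp; ring
      have h5 : 0 ≤ Real.pi ^ 2 / (2 * τ) * (2 * ‖v - u‖ ^ 2 + 2 * τ - ‖v - r • u‖ ^ 2) :=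
        mul_nonneg (by positivity) (by linarith)
      linarith
    calc _ ≤ 2 ^ ((Module.finrank ℝ V : ℝ) / 2) * (Real.pi / (2 * τ)) ^ ((Module.finrank ℝ V : ℝ) / 2) *
        (Real.exp (Real.pi ^ 2) * Real.exp (-(Real.pi ^ 2 / (2 * τ)) * ‖v - r • u‖ ^ 2)) := by
          gcongr
      _ = _ := by ring
  have hm : Measurable fun w : V => ENNReal.ofReal (gaussDensity (2 * τ) (v - w)) :=
    ((continuous_gaussDensity (2 * τ)).comp (continuous_const.sub continuous_id)).measurable.ennreal_ofReal
  have hmul : ENNReal.ofReal √τ *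
      ∫⁻ u, ENNReal.ofReal (gaussDensity τ (v - u)) ∂(unitSphereMeasure V) ≤ ENNReal.ofReal K := by
    calc _ = ∫⁻ r in Ioc 1 (1 + √τ),
          ∫⁻ u, ENNReal.ofReal (gaussDensity τ (v - u)) ∂(unitSphereMeasure V) := by
          rw [setLIntegral_const, Real.volume_Ioc, mul_comm]
          congr 2
          ring
      _ ≤ ∫⁻ r in Ioc 1 (1 + √τ), ∫⁻ u, ENNReal.ofReal K *
          ENNReal.ofReal (gaussDensity (2 * τ) (v - r • u)) ∂(unitSphereMeasure V) := by
          refine setLIntegral_mono' measurableSet_Ioc fun r hr => lintegral_mono_ae ?_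
          filter_upwards [ae_norm_eq_one] with u hu
          rw [← ENNReal.ofReal_mul hK0]
          exact ENNReal.ofReal_le_ofReal (hpt u hu r hr)
      _ ≤ ∫⁻ w : V, ENNReal.ofReal K * ENNReal.ofReal (gaussDensity (2 * τ) (v - w)) :=
          setLIntegral_lintegral_unitSphere_le (hm.const_mul _) measurableSet_Ioc
            fun r hr => hr.1.le
      _ = ENNReal.ofReal K := by
          rw [lintegral_const_mul _ hm, lintegral_sub_left_eq_self
            (fun w : V => ENNReal.ofReal (gaussDensity (2 * τ) w)) v,
            lintegral_gaussDensity (by positivity), mul_one]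
  rw [ENNReal.ofReal_div_of_pos hsτ, ENNReal.le_div_iff_mul_le (by simp [hτ]) (by simp), mul_comm]
  exact hmul

end UnitSphereMeasure

/-! ### Decay for the Bessel-type equation. -/

section Decay

open Set

/-- Energy estimate for the Bessel-type equation `w'' + (n / r) w' + w = 0`. -/
theorem exists_abs_le_of_bessel_system {w S : ℝ → ℝ} {n : ℕ}
    (hw : ∀ r, HasDerivAt w (-S r) r)
    (hS : ∀ r, 0 < r → HasDerivAt S (w r - n * S r / r) r) :
    ∃ C : ℝ, 0 ≤ C ∧ ∀ r, 1 ≤ r → w r ^ 2 * r ^ n ≤ C := by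
  -- For this a the function r^a w satisfies a second-order equation without first-order term. As
  -- r^a z is the derivative of r^a w, E is its harmonic-oscillator energy.
  set a : ℝ := n / 2 with ha
  set b : ℝ := |a ^ 2 - a| with hb
  set z : ℝ → ℝ := fun r => -S r + a * w r / r with hz
  set E : ℝ → ℝ := fun r => r ^ n * (w r ^ 2 + z r ^ 2) with hE
  have hzd : ∀ r, 0 < r → HasDerivAt z (-w r - a * z r / r + (a ^ 2 - a) * w r / r ^ 2) r := by
    intro r hr
    have h := (hS r hr).neg.add (((hw r).const_mul a).div (hasDerivAt_id r) hr.ne')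
    refine h.congr_deriv ?_
    simp only [hz, id, ha]
    field_simp
    ring
  have hEd : ∀ r, 0 < r → HasDerivAt E (r ^ n * (2 * (a ^ 2 - a) * (w r * z r) / r ^ 2)) r := by
    intro r hr
    have h := (hasDerivAt_pow n r).mul (((hw r).pow 2).add ((hzd r hr).pow 2))
    refine h.congr_deriv ?_
    have hSz : S r = a * w r / r - z r := by simp only [hz]; ring
    have hn : (n : ℝ) * r ^ (n - 1) = 2 * a * r ^ n / r := by
      rcases n with _ | k
      · simp [ha]
      · simp only [ha, Nat.add_sub_cancel]
        field_simp
        ring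
    simp only [Pi.add_apply, Pi.pow_apply]
    rw [hn, hSz]
    field_simp
    ring
  -- Since |E'| ≤ b E / r², the factor exp(b / r), with logarithmic derivative -b / r², makes H
  -- nonincreasing; it stays between 1 and exp b for r ≥ 1.
  set H : ℝ → ℝ := fun r => E r * Real.exp (b / r) with hH
  have hHd : ∀ r, 0 < r → HasDerivAt H (Real.exp (b / r) *
      (r ^ n / r ^ 2 * (2 * (a ^ 2 - a) * (w r * z r) - b * (w r ^ 2 + z r ^ 2)))) r := by
    intro r hr
    have h := (hEd r hr).mul (((hasDerivAt_const r b).div (hasDerivAt_id r) hr.ne').exp)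
    refine h.congr_deriv ?_
    simp only [hE, id, Pi.div_apply]
    field_simp
    ring
  have hanti : AntitoneOn H (Ici 1) := by
    refine antitoneOn_of_deriv_nonpos (convex_Ici 1) ?_ ?_ ?_
    · exact fun r hr => (hHd r (zero_lt_one.trans_le hr)).continuousAt.continuousWithinAt
    · intro r hr
      rw [interior_Ici] at hr
      exact (hHd r (zero_lt_one.trans hr)).differentiableAt.differentiableWithinAt
    · intro r hr
      rw [interior_Ici] at hr
      have hr0 : 0 < r := zero_lt_one.trans hr
      rw [(hHd r hr0).deriv]
      refine mul_nonpos_of_nonneg_of_nonpos (Real.exp_pos _).le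
        (mul_nonpos_of_nonneg_of_nonpos (by positivity) ?_)
      have h1 : (a ^ 2 - a) * (w r * z r) ≤ b * |w r * z r| := by
        rw [hb, ← abs_mul]; exact le_abs_self _
      have h2 : 2 * |w r * z r| ≤ w r ^ 2 + z r ^ 2 := by
        rw [abs_mul, ← sq_abs (w r), ← sq_abs (z r)]
        nlinarith [sq_nonneg (|w r| - |z r|)]
      have hb0 : 0 ≤ b := abs_nonneg _
      nlinarith
  have hE0 : ∀ r, 0 < r → 0 ≤ E r := fun r hr => by positivity
  refine ⟨H 1, mul_nonneg (hE0 1 one_pos) (Real.exp_pos _).le, fun r hr => ?_⟩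
  have hr0 : 0 < r := zero_lt_one.trans_le hr
  calc w r ^ 2 * r ^ n ≤ E r := by
        simp only [hE]
        nlinarith [mul_nonneg (pow_pos hr0 n).le (sq_nonneg (z r))]
    _ ≤ E r * Real.exp (b / r) :=
        le_mul_of_one_le_right (hE0 r hr0) (Real.one_le_exp (by positivity))
    _ ≤ H 1 := hanti (mem_Ici.2 le_rfl) hr hr

end Decay

/-! ### Fourier decay of surface measure. -/

section SphereDecay

open Set
open scoped RealInnerProductSpace

variable {ι : Type*} [Fintype ι] [DecidableEq ι]

local notation "σ" => unitSphereMeasure (EuclideanSpace ℝ ι)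

theorem integrable_unitSphere_of_continuous {V G : Type*} [NormedAddCommGroup V]
    [InnerProductSpace ℝ V] [FiniteDimensional ℝ V] [MeasurableSpace V] [BorelSpace V]
    [NormedAddCommGroup G] {g : V → G} (hg : Continuous g) {C : ℝ}
    (hC : ∀ u, ‖u‖ = 1 → ‖g u‖ ≤ C) : Integrable g (unitSphereMeasure V) :=
  Integrable.of_bound hg.aestronglyMeasurable C (ae_norm_eq_one.mono hC)

theorem abs_coord_le_one {u : EuclideanSpace ℝ ι} (hu : ‖u‖ = 1) (i : ι) : |u i| ≤ 1 := by
  simpa [hu] using PiLp.norm_apply_le u i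

theorem sum_sq_coord_eq_one {u : EuclideanSpace ℝ ι} (hu : ‖u‖ = 1) : ∑ i, u i ^ 2 = 1 := by
  have := EuclideanSpace.real_norm_sq_eq u
  rw [hu] at this
  linarith

theorem hasDerivAt_integral_unitSphere {F F' : ℝ → EuclideanSpace ℝ ι → ℝ} {C : ℝ} (r : ℝ)
    (hF : ∀ r, Continuous (F r)) (hF' : ∀ r, Continuous (F' r))
    (hFC : ∀ u, ‖u‖ = 1 → |F r u| ≤ C) (hFC' : ∀ x u, ‖u‖ = 1 → |F' x u| ≤ C)
    (hd : ∀ x u, HasDerivAt (fun x => F x u) (F' x u) x) :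
    HasDerivAt (fun x => ∫ u, F x u ∂σ) (∫ u, F' r u ∂σ) r :=
  (hasDerivAt_integral_of_dominated_loc_of_deriv_le (bound := fun _ => C) (s := univ)
    Filter.univ_mem (Filter.Eventually.of_forall fun x => (hF x).aestronglyMeasurable)
    (integrable_unitSphere_of_continuous (hF r) hFC) (hF' r).aestronglyMeasurable
    (ae_norm_eq_one.mono fun u hu x _ => hFC' x u hu) (integrable_const C)
    (ae_of_all _ fun u x _ => hd x u)).2

theorem hasDerivAt_integral_cos_unitSphere (i : ι) (r : ℝ) :
    HasDerivAt (fun r => ∫ u, Real.cos (r * u i) ∂σ) (-∫ u, u i * Real.sin (r * u i) ∂σ) r := by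
  rw [← integral_neg]
  refine hasDerivAt_integral_unitSphere (C := 1) (F := fun r u => Real.cos (r * u i))
    (F' := fun r u => -(u i * Real.sin (r * u i))) r (fun r => by fun_prop) (fun r => by fun_prop)
    (fun u _ => Real.abs_cos_le_one _) (fun x u hu => ?_) fun x u => ?_
  · rw [abs_neg, abs_mul]
    exact mul_le_one₀ (abs_coord_le_one hu i) (abs_nonneg _) (Real.abs_sin_le_one _)
  · have := ((hasDerivAt_id x).mul_const (u i)).cos
    refine this.congr_deriv ?_
    simp only [id]; ring

theorem hasDerivAt_integral_mul_sin_unitSphere (i : ι) (r : ℝ) :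
    HasDerivAt (fun r => ∫ u, u i * Real.sin (r * u i) ∂σ)
      (∫ u, u i ^ 2 * Real.cos (r * u i) ∂σ) r := by
  refine hasDerivAt_integral_unitSphere (C := 1) (F := fun r u => u i * Real.sin (r * u i))
    (F' := fun r u => u i ^ 2 * Real.cos (r * u i)) r (fun r => by fun_prop) (fun r => by fun_prop)
    (fun u hu => ?_) (fun x u hu => ?_) fun x u => ?_
  · rw [abs_mul]
    exact mul_le_one₀ (abs_coord_le_one hu i) (abs_nonneg _) (Real.abs_sin_le_one _)
  · rw [abs_mul, abs_pow]
    exact mul_le_one₀ (pow_le_one₀ (abs_nonneg _) (abs_coord_le_one hu i)) (abs_nonneg _)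
      (Real.abs_cos_le_one _)
  · have := (((hasDerivAt_id x).mul_const (u i)).sin).const_mul (u i)
    refine this.congr_deriv ?_
    simp only [id]; ring

/-- Reflection in the line spanned by the unit vector `cos θ e_i + sin θ e_j`. -/
def planeReflection (i j : ι) (θ : ℝ) : EuclideanSpace ℝ ι ≃ₗᵢ[ℝ] EuclideanSpace ℝ ι :=
  (ℝ ∙ (Real.cos θ • EuclideanSpace.single i (1 : ℝ) +
    Real.sin θ • EuclideanSpace.single j (1 : ℝ))).reflection

theorem planeReflection_apply {i j : ι} (hij : i ≠ j) (θ : ℝ) (u : EuclideanSpace ℝ ι) (k : ι) :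
    planeReflection i j θ u k =
      2 * (Real.cos θ * u i + Real.sin θ * u j) *
        (Real.cos θ * (if k = i then 1 else 0) + Real.sin θ * (if k = j then 1 else 0)) - u k := by
  set e := Real.cos θ • EuclideanSpace.single i (1 : ℝ) +
    Real.sin θ • EuclideanSpace.single j (1 : ℝ) with he
  have hin : ∀ v : EuclideanSpace ℝ ι, ⟪e, v⟫ = Real.cos θ * v i + Real.sin θ * v j := by
    intro v
    simp [he, inner_add_left, inner_smul_left, EuclideanSpace.inner_single_left]
  have hn : ‖e‖ = 1 := by
    have h : ‖e‖ ^ 2 = 1 := by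
      rw [← real_inner_self_eq_norm_sq, hin]
      simp [he, hij, hij.symm]
      nlinarith [Real.sin_sq_add_cos_sq θ]
    exact (pow_eq_one_iff_of_nonneg (norm_nonneg e) two_ne_zero).1 h
  unfold planeReflection
  rw [Submodule.reflection_singleton_apply, ← he, hin]
  simp only [RCLike.ofReal_real_eq_id, id, hn, one_pow, div_one]
  simp [he]
  split_ifs <;> ring

/-- The infinitesimal rotation identity behind the Bessel equation. -/
theorem integral_mul_sin_eq_integral_sq_mul_cos {i j : ι} (hij : i ≠ j) (r : ℝ) :
    ∫ u, u i * Real.sin (r * u i) ∂σ = r * ∫ u, u j ^ 2 * Real.cos (r * u i) ∂σ := by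
  set X : ℝ → EuclideanSpace ℝ ι → ℝ := fun θ u =>
    2 * (Real.cos θ * u i + Real.sin θ * u j) * Real.cos θ - u i with hX
  set Y : ℝ → EuclideanSpace ℝ ι → ℝ := fun θ u =>
    2 * (Real.cos θ * u i + Real.sin θ * u j) * Real.sin θ - u j with hY
  set X' : ℝ → EuclideanSpace ℝ ι → ℝ := fun θ u =>
    2 * (-Real.sin θ * u i + Real.cos θ * u j) * Real.cos θ +
      2 * (Real.cos θ * u i + Real.sin θ * u j) * -Real.sin θ with hX'
  set Y' : ℝ → EuclideanSpace ℝ ι → ℝ := fun θ u =>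
    2 * (-Real.sin θ * u i + Real.cos θ * u j) * Real.sin θ +
      2 * (Real.cos θ * u i + Real.sin θ * u j) * Real.cos θ with hY'
  have hXd : ∀ θ u, HasDerivAt (fun θ => X θ u) (X' θ u) θ := fun θ u =>
    ((((Real.hasDerivAt_cos θ).mul_const (u i)).add
      ((Real.hasDerivAt_sin θ).mul_const (u j))).const_mul 2 |>.mul
        (Real.hasDerivAt_cos θ)).sub_const (u i)
  have hYd : ∀ θ u, HasDerivAt (fun θ => Y θ u) (Y' θ u) θ := fun θ u =>
    ((((Real.hasDerivAt_cos θ).mul_const (u i)).add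
      ((Real.hasDerivAt_sin θ).mul_const (u j))).const_mul 2 |>.mul
        (Real.hasDerivAt_sin θ)).sub_const (u j)
  have hXc : ∀ θ, Continuous (X θ) := fun θ => by simp only [hX]; fun_prop
  have hYc : ∀ θ, Continuous (Y θ) := fun θ => by simp only [hY]; fun_prop
  have hX'c : ∀ θ, Continuous (X' θ) := fun θ => by simp only [hX']; fun_prop
  have hY'c : ∀ θ, Continuous (Y' θ) := fun θ => by simp only [hY']; fun_prop
  have hcomb : ∀ {a b x y : ℝ}, |a| ≤ 1 → |b| ≤ 1 → |x| ≤ 1 → |y| ≤ 1 → |a * x + b * y| ≤ 2 := by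
    intro a b x y ha hb hx hy
    refine (abs_add_le _ _).trans ?_
    rw [abs_mul, abs_mul]
    nlinarith [abs_nonneg a, abs_nonneg b, abs_nonneg x, abs_nonneg y]
  have hprod : ∀ {x y M N : ℝ}, |x| ≤ M → |y| ≤ N → |x * y| ≤ M * N := by
    intro x y M N hx hy
    rw [abs_mul]
    exact mul_le_mul hx hy (abs_nonneg _) ((abs_nonneg _).trans hx)
  have hcomb4 : ∀ {a b x y s : ℝ}, |a| ≤ 1 → |b| ≤ 1 → |x| ≤ 1 → |y| ≤ 1 → |s| ≤ 1 →
      |2 * (a * x + b * y) * s| ≤ 4 := by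
    intro a b x y s ha hb hx hy hs
    have h2 : |(2 : ℝ)| ≤ 2 := by norm_num
    exact (hprod (hprod h2 (hcomb ha hb hx hy)) hs).trans (by norm_num)
  have hns : ∀ θ, |-Real.sin θ| ≤ 1 := fun θ => by rw [abs_neg]; exact Real.abs_sin_le_one θ
  have hYb : ∀ θ u, ‖u‖ = 1 → |Y θ u| ≤ 5 := fun θ u hu =>
    (abs_sub _ _).trans (by
      have := hcomb4 (Real.abs_cos_le_one θ) (Real.abs_sin_le_one θ) (abs_coord_le_one hu i)
        (abs_coord_le_one hu j) (Real.abs_sin_le_one θ)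
      linarith [abs_coord_le_one hu j])
  have hX'b : ∀ θ u, ‖u‖ = 1 → |X' θ u| ≤ 8 := fun θ u hu =>
    (abs_add_le _ _).trans (by
      have h1 := hcomb4 (hns θ) (Real.abs_cos_le_one θ) (abs_coord_le_one hu i)
        (abs_coord_le_one hu j) (Real.abs_cos_le_one θ)
      have h2 := hcomb4 (Real.abs_cos_le_one θ) (Real.abs_sin_le_one θ) (abs_coord_le_one hu i)
        (abs_coord_le_one hu j) (hns θ)
      linarith)
  have hY'b : ∀ θ u, ‖u‖ = 1 → |Y' θ u| ≤ 8 := fun θ u hu =>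
    (abs_add_le _ _).trans (by
      have h1 := hcomb4 (hns θ) (Real.abs_cos_le_one θ) (abs_coord_le_one hu i)
        (abs_coord_le_one hu j) (Real.abs_sin_le_one θ)
      have h2 := hcomb4 (Real.abs_cos_le_one θ) (Real.abs_sin_le_one θ) (abs_coord_le_one hu i)
        (abs_coord_le_one hu j) (Real.abs_cos_le_one θ)
      linarith)
  -- The reflection at angle θ carries the coordinates (u i, u j) to (X θ u, Y θ u), so invariance
  -- makes the integral independent of θ. The identity is the vanishing of its derivative at θ = 0.
  have hconst : ∀ θ, ∫ u, Y θ u * Real.sin (r * X θ u) ∂σ =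
      ∫ u : EuclideanSpace ℝ ι, u j * Real.sin (r * u i) ∂σ := by
    intro θ
    rw [← integral_comp_linearIsometryEquiv_unitSphere (planeReflection i j θ)
      (fun u : EuclideanSpace ℝ ι => u j * Real.sin (r * u i))]
    congr 1 with u
    simp only [planeReflection_apply hij, hX, hY, if_neg hij, if_neg hij.symm, if_true]
    ring_nf
  have hd := hasDerivAt_integral_unitSphere (ι := ι) (C := 5 + 8 + 5 * (|r| * 8))
    (F := fun θ u => Y θ u * Real.sin (r * X θ u))
    (F' := fun θ u => Y' θ u * Real.sin (r * X θ u) +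
      Y θ u * (Real.cos (r * X θ u) * (r * X' θ u))) 0
    (fun θ => (hYc θ).mul (Real.continuous_sin.comp ((hXc θ).const_mul r)))
    (fun θ => ((hY'c θ).mul (Real.continuous_sin.comp ((hXc θ).const_mul r))).add
      ((hYc θ).mul ((Real.continuous_cos.comp ((hXc θ).const_mul r)).mul
        ((hX'c θ).const_mul r))))
    (fun u hu => by
      have := hprod (hYb 0 u hu) (Real.abs_sin_le_one (r * X 0 u))
      have : 0 ≤ |r| := abs_nonneg r
      linarith)
    (fun θ u hu => by
      have h1 := hprod (hY'b θ u hu) (Real.abs_sin_le_one (r * X θ u))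
      have h2 := hprod (hYb θ u hu) (hprod (Real.abs_cos_le_one (r * X θ u))
        (hprod (le_refl |r|) (hX'b θ u hu)))
      refine (abs_add_le _ _).trans ?_
      linarith)
    (fun θ u => (hYd θ u).mul (((hXd θ u).const_mul r).sin))
  simp only [hconst] at hd
  have h0 := hd.unique (hasDerivAt_const 0 _)
  have hi1 : Integrable (fun u : EuclideanSpace ℝ ι => u i * Real.sin (r * u i)) σ :=
    integrable_unitSphere_of_continuous (by fun_prop) (C := 1) fun u hu => by
      rw [Real.norm_eq_abs]
      exact (hprod (abs_coord_le_one hu i) (Real.abs_sin_le_one _)).trans (by norm_num)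
  have hi2 : Integrable (fun u : EuclideanSpace ℝ ι => u j ^ 2 * Real.cos (r * u i)) σ :=
    integrable_unitSphere_of_continuous (by fun_prop) (C := 1) fun u hu => by
      rw [Real.norm_eq_abs, sq]
      exact (hprod (hprod (abs_coord_le_one hu j) (abs_coord_le_one hu j))
        (Real.abs_cos_le_one _)).trans (by norm_num)
  -- At θ = 0 the values are X = u i, Y = -u j, X' = 2 u j and Y' = 2 u i.
  have e : ∀ u : EuclideanSpace ℝ ι, Y' 0 u * Real.sin (r * X 0 u) +
      Y 0 u * (Real.cos (r * X 0 u) * (r * X' 0 u)) =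
      2 * (u i * Real.sin (r * u i) - r * (u j ^ 2 * Real.cos (r * u i))) := by
    intro u
    simp only [hX, hY, hX', hY', Real.cos_zero, Real.sin_zero]
    ring_nf
  simp only [e] at h0
  rw [integral_const_mul, integral_sub hi1 (hi2.const_mul r), integral_const_mul] at h0
  linarith

/-- With w(r) = ∫ cos(r u_i) and S(r) = ∫ u_i sin(r u_i) one has w' = -S and S' = ∫ u_i² cos(r u_i).
As ∑ u_j² = 1 on the sphere and each j ≠ i contributes S / r to ∑_{j ≠ i} ∫ u_j² cos(r u_i), this is
the Bessel-type system with n = card ι - 1. For r ≤ 1 the total mass bounds w. -/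
theorem exists_abs_integral_cos_unitSphere_le (i : ι) :
    ∃ C : ℝ, 0 ≤ C ∧ ∀ r, 0 < r →
      (∫ u, Real.cos (r * u i) ∂σ) ^ 2 * r ^ (Fintype.card ι - 1) ≤ C := by
  have hbessel : ∀ r, 0 < r → HasDerivAt (fun r => ∫ u, u i * Real.sin (r * u i) ∂σ)
      ((∫ u, Real.cos (r * u i) ∂σ) - ((Fintype.card ι - 1 : ℕ) : ℝ) *
        (∫ u, u i * Real.sin (r * u i) ∂σ) / r) r := by
    intro r hr
    refine (hasDerivAt_integral_mul_sin_unitSphere i r).congr_deriv ?_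
    have hint : ∀ j, Integrable (fun u : EuclideanSpace ℝ ι => u j ^ 2 * Real.cos (r * u i)) σ :=
      fun j => integrable_unitSphere_of_continuous (by fun_prop) (C := 1) fun u hu => by
        rw [Real.norm_eq_abs, abs_mul, abs_pow]
        exact mul_le_one₀ (pow_le_one₀ (abs_nonneg _) (abs_coord_le_one hu j)) (abs_nonneg _)
          (Real.abs_cos_le_one _)
    have hsum : ∑ j, ∫ u, u j ^ 2 * Real.cos (r * u i) ∂σ = ∫ u, Real.cos (r * u i) ∂σ := by
      rw [← integral_finsetSum _ fun j _ => hint j]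
      refine integral_congr_ae (ae_norm_eq_one.mono fun u hu => ?_)
      simp only
      rw [← Finset.sum_mul, sum_sq_coord_eq_one hu, one_mul]
    rw [← Finset.add_sum_erase _ _ (Finset.mem_univ i)] at hsum
    have hj : ∑ j ∈ Finset.univ.erase i, r * ∫ u, u j ^ 2 * Real.cos (r * u i) ∂σ =
        ((Fintype.card ι - 1 : ℕ) : ℝ) * ∫ u, u i * Real.sin (r * u i) ∂σ := by
      rw [Finset.sum_congr rfl fun j hj =>
        (integral_mul_sin_eq_integral_sq_mul_cos (Finset.ne_of_mem_erase hj).symm r).symm,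
        Finset.sum_const, Finset.card_erase_of_mem (Finset.mem_univ i), Finset.card_univ,
        nsmul_eq_mul]
    rw [← Finset.mul_sum] at hj
    rw [← hj, ← hsum, mul_div_cancel_left₀ _ hr.ne', add_sub_cancel_right]
  obtain ⟨C, hC0, hC⟩ := exists_abs_le_of_bessel_system
    (hasDerivAt_integral_cos_unitSphere i) hbessel
  set M : ℝ := (unitSphereMeasure (EuclideanSpace ℝ ι)).real univ
  have hM : ∀ r, |∫ u, Real.cos (r * u i) ∂σ| ≤ M := by
    intro r
    have := norm_integral_le_of_norm_le_const (μ := σ)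
      (f := fun u => Real.cos (r * u i)) (C := 1)
      (ae_of_all _ fun u => Real.abs_cos_le_one (r * u i))
    simpa using this
  refine ⟨C + M ^ 2, by positivity, fun r hr => ?_⟩
  rcases le_total 1 r with h | h
  · linarith [hC r h, sq_nonneg M]
  · have h1 : (∫ u, Real.cos (r * u i) ∂σ) ^ 2 ≤ M ^ 2 := sq_le_sq' (by linarith [abs_le.1 (hM r)]) (abs_le.1 (hM r)).2
    have h2 : r ^ (Fintype.card ι - 1) ≤ 1 := pow_le_one₀ hr.le h
    nlinarith [sq_nonneg M, pow_nonneg hr.le (Fintype.card ι - 1)]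

/-- Decay of the Fourier transform of the surface measure on the unit sphere. -/
theorem exists_norm_fourier_unitSphere_le [Nonempty ι] :
    ∃ C : ℝ, 0 ≤ C ∧ ∀ ξ : EuclideanSpace ℝ ι,
      ‖∫ u, (Real.fourierChar ⟪u, ξ⟫ : ℂ) ∂σ‖ ^ 2 * ‖ξ‖ ^ (Fintype.card ι - 1) ≤ C := by
  obtain ⟨i⟩ := ‹Nonempty ι›
  obtain ⟨C, hC0, hC⟩ := exists_abs_integral_cos_unitSphere_le i
  set M : ℝ := (unitSphereMeasure (EuclideanSpace ℝ ι)).real univ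
  refine ⟨C + M ^ 2, by positivity, fun ξ => ?_⟩
  have hM : ‖∫ u, (Real.fourierChar ⟪u, ξ⟫ : ℂ) ∂σ‖ ≤ M := by
    have := norm_integral_le_of_norm_le_const (μ := σ) (C := 1)
      (f := fun u => (Real.fourierChar ⟪u, ξ⟫ : ℂ))
      (ae_of_all _ fun u : EuclideanSpace ℝ ι => (Circle.norm_coe _).le)
    simpa using this
  rcases eq_or_ne ξ 0 with rfl | hξ
  · have h2 : (‖(0 : EuclideanSpace ℝ ι)‖) ^ (Fintype.card ι - 1) ≤ 1 :=
      pow_le_one₀ (norm_nonneg _) (by simp)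
    have h3 := pow_le_pow_left₀ (norm_nonneg _) hM 2
    calc _ ≤ M ^ 2 * 1 := mul_le_mul h3 h2 (by positivity) (by positivity)
      _ ≤ _ := by linarith
  have hξ0 : 0 < ‖ξ‖ := norm_pos_iff.2 hξ
  -- Reflection in the hyperplane orthogonal to η - ξ carries η to ξ, which reduces the transform to
  -- the i-th axis; its sine part vanishes by u ↦ -u.
  set η : EuclideanSpace ℝ ι := EuclideanSpace.single i ‖ξ‖
  have hη : ‖η‖ = ‖ξ‖ := by simp [η]
  have hA := Submodule.reflection_sub hη
  set A := (ℝ ∙ (η - ξ))ᗮ.reflection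
  have e1 : ∫ u, (Real.fourierChar ⟪u, ξ⟫ : ℂ) ∂σ =
      ∫ u : EuclideanSpace ℝ ι, (Real.fourierChar (‖ξ‖ * u i) : ℂ) ∂σ := by
    rw [← integral_comp_linearIsometryEquiv_unitSphere A
      (fun u => (Real.fourierChar ⟪u, ξ⟫ : ℂ))]
    congr 1 with u
    rw [← hA, LinearIsometryEquiv.inner_map_map]
    simp [η, EuclideanSpace.inner_single_right]
  have e2 : ∫ u : EuclideanSpace ℝ ι, (Real.fourierChar (‖ξ‖ * u i) : ℂ) ∂σ =
      ((∫ u : EuclideanSpace ℝ ι, Real.cos (2 * Real.pi * ‖ξ‖ * u i) ∂σ : ℝ) : ℂ) := by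
    have hsin : ∫ u : EuclideanSpace ℝ ι, Real.sin (2 * Real.pi * ‖ξ‖ * u i) ∂σ = 0 := by
      have := integral_comp_linearIsometryEquiv_unitSphere
        (LinearIsometryEquiv.neg ℝ (E := EuclideanSpace ℝ ι))
        (fun u => Real.sin (2 * Real.pi * ‖ξ‖ * u i))
      simp only [LinearIsometryEquiv.coe_neg, PiLp.neg_apply, mul_neg, Real.sin_neg,
        integral_neg] at this
      linarith
    have e : ∀ u : EuclideanSpace ℝ ι, (Real.fourierChar (‖ξ‖ * u i) : ℂ) =
        (Real.cos (2 * Real.pi * ‖ξ‖ * u i) : ℂ) +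
          (Real.sin (2 * Real.pi * ‖ξ‖ * u i) : ℂ) * Complex.I := by
      intro u
      rw [Real.fourierChar_apply, Complex.exp_mul_I, ← Complex.ofReal_cos, ← Complex.ofReal_sin,
        ← mul_assoc]
    simp only [e]
    rw [integral_add, integral_mul_const, integral_complex_ofReal, integral_complex_ofReal, hsin]
    · simp
    · exact (integrable_unitSphere_of_continuous (C := 1)
        (Real.continuous_cos.comp (by fun_prop)) fun u _ => Real.abs_cos_le_one _).ofReal
    · exact (integrable_unitSphere_of_continuous (C := 1)
        (Real.continuous_sin.comp (by fun_prop)) fun u _ => Real.abs_sin_le_one _).ofReal.mul_const _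
  rw [e1, e2, Complex.norm_real, Real.norm_eq_abs, sq_abs]
  have h := hC (2 * Real.pi * ‖ξ‖) (by positivity)
  have hle : ‖ξ‖ ^ (Fintype.card ι - 1) ≤ (2 * Real.pi * ‖ξ‖) ^ (Fintype.card ι - 1) := by
    gcongr
    nlinarith [Real.pi_gt_three]
  calc _ ≤ (∫ u : EuclideanSpace ℝ ι, Real.cos (2 * Real.pi * ‖ξ‖ * u i) ∂σ) ^ 2 *
        (2 * Real.pi * ‖ξ‖) ^ (Fintype.card ι - 1) := by gcongr
    _ ≤ C := h
    _ ≤ _ := by linarith [sq_nonneg M]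

end SphereDecay

/-! ### Block coordinates on ℝ^{md}, product integrals and radial weights. -/

section Blocks

open scoped RealInnerProductSpace ENNReal

variable {m n d : ℕ}

theorem measurePreserving_uncurry :
    MeasurePreserving (MeasurableEquiv.curry (Fin m) (Fin d) ℝ).symm := by
  refine ⟨(MeasurableEquiv.curry (Fin m) (Fin d) ℝ).symm.measurable, ?_⟩
  refine (Measure.pi_eq fun s hs => ?_).symm
  rw [Measure.map_apply (MeasurableEquiv.curry (Fin m) (Fin d) ℝ).symm.measurable
    (MeasurableSet.univ_pi hs)]
  have : (MeasurableEquiv.curry (Fin m) (Fin d) ℝ).symm ⁻¹' Set.univ.pi s =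
      Set.univ.pi fun j => Set.univ.pi fun i => s (j, i) := by
    ext y
    simp [MeasurableEquiv.coe_curry_symm, Set.mem_pi, Function.uncurry]
  rw [this, volume_pi_pi]
  simp_rw [volume_pi_pi]
  rw [Fintype.prod_prod_type]

/-- The measurable equivalence sending a point of `ℝ^{md}` to the tuple of its blocks. -/
def blockEquiv (m d : ℕ) :
    EuclideanSpace ℝ (Fin m × Fin d) ≃ᵐ (Fin m → EuclideanSpace ℝ (Fin d)) :=
  (MeasurableEquiv.toLp 2 (Fin m × Fin d → ℝ)).symm.trans
    ((MeasurableEquiv.curry (Fin m) (Fin d) ℝ).trans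
      (MeasurableEquiv.piCongrRight fun _ => MeasurableEquiv.toLp 2 (Fin d → ℝ)))

theorem measurePreserving_blockEquiv : MeasurePreserving (blockEquiv m d) := by
  have h1 : MeasurePreserving (MeasurableEquiv.toLp 2 (Fin m × Fin d → ℝ)).symm :=
    EuclideanSpace.volume_preserving_symm_measurableEquiv_toLp (Fin m × Fin d)
  have h2 : MeasurePreserving (MeasurableEquiv.curry (Fin m) (Fin d) ℝ) :=
    measurePreserving_uncurry.symm
  have h3 : MeasurePreserving (MeasurableEquiv.piCongrRight
      fun _ : Fin m => MeasurableEquiv.toLp 2 (Fin d → ℝ)) :=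
    volume_preserving_pi fun _ : Fin m => PiLp.volume_preserving_toLp (Fin d)
  exact h3.comp (h2.comp h1)

theorem continuous_block (j : Fin m) :
    Continuous (block j : EuclideanSpace ℝ (Fin m × Fin d) → EuclideanSpace ℝ (Fin d)) := by
  unfold block; fun_prop

theorem block_sub (j : Fin m) (u v : EuclideanSpace ℝ (Fin m × Fin d)) :
    block j (u - v) = block j u - block j v := rfl

theorem inner_eq_sum_block (u v : EuclideanSpace ℝ (Fin m × Fin d)) :
    ⟪u, v⟫ = ∑ j, ⟪block j u, block j v⟫ := by
  simp only [PiLp.inner_apply, block]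
  rw [Fintype.sum_prod_type]

theorem norm_block_le (j : Fin m) (u : EuclideanSpace ℝ (Fin m × Fin d)) : ‖block j u‖ ≤ ‖u‖ := by
  have h : ‖u‖ ^ 2 = ∑ j, ‖block j u‖ ^ 2 := by
    simp only [← real_inner_self_eq_norm_sq]
    exact inner_eq_sum_block u u
  refine le_of_sq_le_sq ?_ (norm_nonneg _)
  rw [h]
  exact Finset.single_le_sum (f := fun j => ‖block j u‖ ^ 2) (fun j _ => by positivity)
    (Finset.mem_univ j)

/-- The diagonal point `(x, …, x)` of `ℝ^{md}`. -/
def diagPoint (m : ℕ) {d : ℕ} (x : EuclideanSpace ℝ (Fin d)) : EuclideanSpace ℝ (Fin m × Fin d) :=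
  WithLp.toLp 2 fun p => x p.2

theorem block_diagPoint (j : Fin m) (x : EuclideanSpace ℝ (Fin d)) :
    block j (diagPoint m x) = x := rfl

theorem continuous_diagPoint :
    Continuous (diagPoint m : EuclideanSpace ℝ (Fin d) → EuclideanSpace ℝ (Fin m × Fin d)) := by
  unfold diagPoint; fun_prop

theorem inner_diagPoint (x : EuclideanSpace ℝ (Fin d)) (ξ : EuclideanSpace ℝ (Fin m × Fin d)) :
    ⟪diagPoint m x, ξ⟫ = ⟪x, ∑ j, block j ξ⟫ := by
  rw [inner_eq_sum_block, inner_sum]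
  rfl

section Pi

variable {E : Type*} [MeasureSpace E] [SigmaFinite (volume : Measure E)]

theorem lintegral_fin_prod_eq_prod (g : Fin n → E → ℝ≥0∞) (hg : ∀ j, Measurable (g j)) :
    ∫⁻ y : Fin n → E, ∏ j, g j (y j) = ∏ j, ∫⁻ x, g j x := by
  induction n with
  | zero => simp [volume_pi]
  | succ n ih =>
    have hmp := (volume_preserving_piFinSuccAbove (fun _ : Fin (n + 1) => E) 0)
    have hm : Measurable fun y : Fin n → E => ∏ j, g j.succ (y j) := by fun_prop
    rw [← hmp.symm.lintegral_comp_emb (MeasurableEquiv.measurableEmbedding _)]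
    simp only [Fin.prod_univ_succ]
    rw [← ih (fun j => g j.succ) fun j => hg _, ← lintegral_prod_mul (hg 0).aemeasurable
      hm.aemeasurable]
    rfl

/-- The variable y 0 carries no weight: integrating it first, translation invariance turns H (∑ y j)
into the constant ∫ H, and the n weighted variables separate. -/
theorem lintegral_sum_mul_prod_tail [AddCommGroup E] [MeasurableAdd₂ E]
    [(volume : Measure E).IsAddRightInvariant] {H w : E → ℝ≥0∞} (hH : Measurable H)
    (hw : Measurable w) :
    ∫⁻ y : Fin (n + 1) → E, H (∑ j, y j) * ∏ j : Fin n, w (y j.succ) =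
      (∫⁻ x, H x) * (∫⁻ x, w x) ^ n := by
  have hmp := (volume_preserving_piFinSuccAbove (fun _ : Fin (n + 1) => E) 0)
  rw [← hmp.symm.lintegral_comp_emb (MeasurableEquiv.measurableEmbedding _)]
  have hm : Measurable fun y : Fin n → E => ∏ j, w (y j) := by fun_prop
  have hm2 : Measurable fun p : E × (Fin n → E) => H (p.1 + ∑ j, p.2 j) * ∏ j, w (p.2 j) := by
    fun_prop
  calc _ = ∫⁻ p : E × (Fin n → E), H (p.1 + ∑ j, p.2 j) * ∏ j, w (p.2 j) := by
        refine lintegral_congr fun p => ?_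
        rw [Fin.sum_univ_succ]
        rfl
    _ = ∫⁻ y : Fin n → E, ∫⁻ x, H (x + ∑ j, y j) * ∏ j, w (y j) := by
        rw [Measure.volume_eq_prod, lintegral_prod_symm' _ hm2]
    _ = ∫⁻ y : Fin n → E, (∫⁻ x, H x) * ∏ j, w (y j) := by
        refine lintegral_congr fun y => ?_
        rw [lintegral_mul_const _ (by fun_prop), lintegral_add_right_eq_self H]
    _ = _ := by
        rw [lintegral_const_mul _ hm, lintegral_fin_prod_eq_prod (fun _ => w) fun _ => hw]
        simp

end Pi

section Weight

variable {V : Type*} [NormedAddCommGroup V] [InnerProductSpace ℝ V] [FiniteDimensional ℝ V]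
  [MeasurableSpace V] [BorelSpace V]

/-- Scaling by L, after the comparison max L ‖ζ‖ ≥ (L / 2) (1 + ‖ζ‖ / L); β above the dimension is
what makes the integral converge. -/
theorem exists_lintegral_max_rpow_le {β : ℝ} (hβ : (Module.finrank ℝ V : ℝ) < β) :
    ∃ C : ℝ, 0 ≤ C ∧ ∀ L : ℝ, 0 < L → ∫⁻ ζ : V, ENNReal.ofReal (max L ‖ζ‖ ^ (-β)) ≤
      ENNReal.ofReal (C * L ^ ((Module.finrank ℝ V : ℝ) - β)) := by
  have hβ0 : 0 ≤ β := (Nat.cast_nonneg _).trans hβ.le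
  set C : ℝ := ∫ ζ : V, (1 + ‖ζ‖) ^ (-β)
  have hint : Integrable fun ζ : V => (1 + ‖ζ‖) ^ (-β) := integrable_one_add_norm hβ
  have hC : 0 ≤ C := integral_nonneg fun ζ => by positivity
  refine ⟨2 ^ β * C, by positivity, fun L hL => ?_⟩
  have hpt : ∀ ζ : V, max L ‖ζ‖ ^ (-β) ≤ 2 ^ β * L ^ (-β) * (1 + ‖L⁻¹ • ζ‖) ^ (-β) := by
    intro ζ
    rw [norm_smul, norm_inv, Real.norm_eq_abs, abs_of_pos hL]
    have h1 : L / 2 * (1 + L⁻¹ * ‖ζ‖) ≤ max L ‖ζ‖ := by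
      have : L / 2 * (1 + L⁻¹ * ‖ζ‖) = (L + ‖ζ‖) / 2 := by field_simp
      rw [this]
      linarith [le_max_left L ‖ζ‖, le_max_right L ‖ζ‖]
    calc max L ‖ζ‖ ^ (-β) ≤ (L / 2 * (1 + L⁻¹ * ‖ζ‖)) ^ (-β) :=
          Real.rpow_le_rpow_of_nonpos (by positivity) h1 (by linarith)
      _ = _ := by
          rw [Real.mul_rpow (by positivity) (by positivity), Real.div_rpow hL.le (by norm_num),
            Real.rpow_neg (by norm_num : (0 : ℝ) ≤ 2)]
          field_simp
  have hint' : Integrable fun ζ : V => 2 ^ β * L ^ (-β) * (1 + ‖L⁻¹ • ζ‖) ^ (-β) :=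
    (hint.comp_smul (inv_ne_zero hL.ne')).const_mul _
  calc _ ≤ ∫⁻ ζ : V, ENNReal.ofReal (2 ^ β * L ^ (-β) * (1 + ‖L⁻¹ • ζ‖) ^ (-β)) :=
        lintegral_mono fun ζ => ENNReal.ofReal_le_ofReal (hpt ζ)
    _ = ENNReal.ofReal (∫ ζ : V, 2 ^ β * L ^ (-β) * (1 + ‖L⁻¹ • ζ‖) ^ (-β)) :=
        (ofReal_integral_eq_lintegral_ofReal hint' (ae_of_all _ fun ζ => by positivity)).symm
    _ = _ := by
        congr 1
        rw [integral_const_mul,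
          Measure.integral_comp_smul volume (fun ζ : V => (1 + ‖ζ‖) ^ (-β)) L⁻¹,
          abs_of_pos (by positivity), inv_pow, inv_inv, smul_eq_mul,
          Real.rpow_sub hL, Real.rpow_natCast, Real.rpow_neg hL.le]
        simp only [C]
        field_simp

end Weight

end Blocks

/-! ### The translated form and its Fourier transform. -/

section Form

open FourierTransform
open scoped RealInnerProductSpace ENNReal

variable {n d : ℕ}

local notation "𝔼" => EuclideanSpace ℝ (Fin d)
local notation "𝕎" => EuclideanSpace ℝ (Fin (n + 1) × Fin d)

/-- The tensor product of functions on `ℝ^d`, as a complex function on `ℝ^{md}`. -/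
def tensorFun {m d : ℕ} (f : Fin m → EuclideanSpace ℝ (Fin d) → ℝ)
    (v : EuclideanSpace ℝ (Fin m × Fin d)) : ℂ := ∏ j, (f j (block j v) : ℂ)

theorem continuous_tensorFun {f : Fin (n + 1) → 𝔼 → ℝ} (hf : ∀ j, Continuous (f j)) :
    Continuous (tensorFun f) := by
  unfold tensorFun
  exact continuous_finsetProd _ fun j _ =>
    Complex.continuous_ofReal.comp ((hf j).comp (continuous_block j))

theorem integral_prod_block (g : Fin (n + 1) → 𝔼 → ℂ) :
    ∫ v : 𝕎, ∏ j, g j (block j v) = ∏ j, ∫ x, g j x := by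
  rw [← integral_fintype_prod_volume_eq_prod]
  exact measurePreserving_blockEquiv.integral_comp (MeasurableEquiv.measurableEmbedding _)
    (fun y : Fin (n + 1) → 𝔼 => ∏ j, g j (y j))

theorem lintegral_prod_block (g : Fin (n + 1) → 𝔼 → ℝ≥0∞) (hg : ∀ j, Measurable (g j)) :
    ∫⁻ v : 𝕎, ∏ j, g j (block j v) = ∏ j, ∫⁻ x, g j x := by
  rw [← lintegral_fin_prod_eq_prod g hg]
  exact measurePreserving_blockEquiv.lintegral_comp_emb (MeasurableEquiv.measurableEmbedding _)
    (fun y : Fin (n + 1) → 𝔼 => ∏ j, g j (y j))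

theorem lintegral_enorm_tensorFun {f : Fin (n + 1) → 𝔼 → ℝ} (hf : ∀ j, Continuous (f j)) :
    ∫⁻ v, ‖tensorFun f v‖ₑ = ∏ j, ∫⁻ x, ‖f j x‖ₑ := by
  rw [← lintegral_prod_block _ fun j => (hf j).measurable.enorm]
  congr 1 with v
  unfold tensorFun
  simp [enorm_eq_nnnorm, nnnorm_prod]

theorem integrable_tensorFun {f : Fin (n + 1) → 𝔼 → ℝ} (hf : ∀ j, Continuous (f j))
    (hc : ∀ j, HasCompactSupport (f j)) : Integrable (tensorFun f) := by
  refine ⟨(continuous_tensorFun hf).aestronglyMeasurable, ?_⟩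
  rw [hasFiniteIntegral_iff_enorm, lintegral_enorm_tensorFun hf]
  exact ENNReal.prod_lt_top fun j _ =>
    ((hf j).integrable_of_hasCompactSupport (hc j)).2

theorem exists_norm_tensorFun_le {f : Fin (n + 1) → 𝔼 → ℝ} (hf : ∀ j, Continuous (f j))
    (hc : ∀ j, HasCompactSupport (f j)) : ∃ M, ∀ v, ‖tensorFun f v‖ ≤ M := by
  choose M hM using fun j => (hf j).bounded_above_of_compact_support (hc j)
  refine ⟨∏ j, M j, fun v => ?_⟩
  unfold tensorFun
  rw [norm_prod]
  refine Finset.prod_le_prod (fun j _ => norm_nonneg _) fun j _ => ?_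
  rw [Complex.norm_real]
  exact hM j _

theorem coe_fourierChar_sum {ι : Type*} (s : Finset ι) (a : ι → ℝ) :
    (Real.fourierChar (∑ j ∈ s, a j) : ℂ) = ∏ j ∈ s, (Real.fourierChar (a j) : ℂ) := by
  classical
  induction s using Finset.induction_on with
  | empty => simp
  | insert j s hj ih =>
    rw [Finset.sum_insert hj, Finset.prod_insert hj, AddChar.map_add_eq_mul, Circle.coe_mul, ih]

theorem fourier_tensorFun (f : Fin (n + 1) → 𝔼 → ℝ) (ξ : 𝕎) :
    𝓕 (tensorFun f) ξ = ∏ j, 𝓕 (fun x => (f j x : ℂ)) (block j ξ) := by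
  simp only [Real.fourier_eq]
  rw [← integral_prod_block fun j x => Real.fourierChar (-⟪x, block j ξ⟫) • (f j x : ℂ)]
  congr 1 with v
  simp only [Circle.smul_def, smul_eq_mul, Finset.prod_mul_distrib, tensorFun]
  congr 1
  rw [inner_eq_sum_block, ← Finset.sum_neg_distrib, coe_fourierChar_sum]

/-- The function `w ↦ ∫∫ h x * ∏ f_j (x - u^j - w^j) dν(u) dx`. -/
def formTranslate (h : 𝔼 → ℝ) (f : Fin (n + 1) → 𝔼 → ℝ) : 𝕎 → ℂ :=
  correlation (volume.prod (unitSphereMeasure 𝕎)) (fun p : 𝔼 × 𝕎 => (h p.1 : ℂ))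
    (fun p => diagPoint (n + 1) p.1 - p.2) (tensorFun f)

theorem measurable_diagPoint_sub :
    Measurable fun p : 𝔼 × 𝕎 => diagPoint (n + 1) p.1 - p.2 :=
  ((continuous_diagPoint.comp continuous_fst).sub continuous_snd).measurable

theorem integrable_fst_form {h : 𝔼 → ℝ} (hh : Continuous h) (hhc : HasCompactSupport h) :
    Integrable (fun p : 𝔼 × 𝕎 => (h p.1 : ℂ)) (volume.prod (unitSphereMeasure 𝕎)) :=
  ((hh.integrable_of_hasCompactSupport hhc).comp_fst _).ofReal

theorem formTranslate_zero (h : 𝔼 → ℝ) (f : Fin (n + 1) → 𝔼 → ℝ) :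
    formTranslate h f 0 = ((∫ p : 𝔼 × 𝕎, h p.1 * ∏ j, f j (p.1 - block j p.2)
      ∂(volume.prod (unitSphereMeasure 𝕎)) : ℝ) : ℂ) := by
  unfold formTranslate correlation
  rw [← integral_complex_ofReal]
  congr 1 with p
  simp [tensorFun, block_sub, block_diagPoint]

/-- A diagonal point pairs with ξ only through ∑ ξ^j, so the x-integral gives the transform of h
there, the u-integral that of the surface measure, and the tensor product factors over the blocks.
-/
theorem fourier_formTranslate {h : 𝔼 → ℝ} {f : Fin (n + 1) → 𝔼 → ℝ} (hh : Continuous h)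
    (hhc : HasCompactSupport h) (hf : ∀ j, Continuous (f j)) (hc : ∀ j, HasCompactSupport (f j))
    (ξ : 𝕎) :
    𝓕 (formTranslate h f) ξ = 𝓕 (fun x => (h x : ℂ)) (∑ j, block j ξ) *
      (∫ u, (Real.fourierChar ⟪u, ξ⟫ : ℂ) ∂(unitSphereMeasure 𝕎)) *
      ∏ j, 𝓕 (fun x => (f j x : ℂ)) (-block j ξ) := by
  unfold formTranslate
  rw [fourier_correlation (integrable_fst_form hh hhc) measurable_diagPoint_sub
    (continuous_tensorFun hf) (integrable_tensorFun hf hc), fourier_tensorFun]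
  congr 1
  rw [Real.fourier_eq, ← integral_prod_mul]
  congr 1 with p
  simp only [Circle.smul_def, smul_eq_mul]
  rw [mul_comm (h p.1 : ℂ), mul_right_comm, ← Circle.coe_mul, ← AddChar.map_add_eq_mul]
  congr 3
  rw [inner_sub_left, inner_diagPoint]
  ring

end Form

/-! ### The low-frequency L¹ bound and the high-frequency L² bound. -/

section FormBounds

open FourierTransform
open scoped RealInnerProductSpace ENNReal

variable {n d : ℕ}

local notation "𝔼" => EuclideanSpace ℝ (Fin d)
local notation "𝕎" => EuclideanSpace ℝ (Fin (n + 1) × Fin d)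

/-- After a change of variables the Gaussian is convolved with surface measure instead of with the
functions. That convolution is at most K / √τ everywhere, which leaves only L¹ norms. -/
theorem exists_enorm_integral_gaussDensity_mul_formTranslate_le (hd : 0 < d) :
    ∃ K : ℝ, 0 ≤ K ∧ ∀ τ : ℝ, 0 < τ → ∀ (h : 𝔼 → ℝ) (f : Fin (n + 1) → 𝔼 → ℝ), Continuous h →
      (∀ j, Continuous (f j)) →
      ‖∫ w : 𝕎, (gaussDensity τ w : ℂ) * formTranslate h f w‖ₑ ≤
        ENNReal.ofReal (K / √τ) * ((∫⁻ x, ‖h x‖ₑ) * ∏ j, ∫⁻ x, ‖f j x‖ₑ) := by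
  have : NeZero d := ⟨hd.ne'⟩
  obtain ⟨K, hK0, hK⟩ := exists_lintegral_gaussDensity_unitSphere_le (V := 𝕎)
  refine ⟨K, hK0, fun τ hτ h f hh hf => ?_⟩
  set F := tensorFun f with hFdef
  have hF : Continuous F := continuous_tensorFun hf
  set ν := unitSphereMeasure 𝕎
  have hg : Continuous (gaussDensity (V := 𝕎) τ) := continuous_gaussDensity τ
  have hgm : Measurable fun w : 𝕎 => ENNReal.ofReal (gaussDensity τ w) :=
    hg.measurable.ennreal_ofReal
  have hFm : Measurable fun w : 𝕎 => ‖F w‖ₑ := hF.measurable.enorm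
  have hhm : Measurable fun x : 𝔼 => ‖h x‖ₑ := hh.measurable.enorm
  have hT := measurable_diagPoint_sub (n := n) (d := d)
  calc ‖∫ w : 𝕎, (gaussDensity τ w : ℂ) * formTranslate h f w‖ₑ
      ≤ ∫⁻ w : 𝕎, ‖(gaussDensity τ w : ℂ) * formTranslate h f w‖ₑ := enorm_integral_le_lintegral_enorm _
    _ ≤ ∫⁻ w : 𝕎, ∫⁻ p : 𝔼 × 𝕎, ENNReal.ofReal (gaussDensity τ w) *
          (‖h p.1‖ₑ * ‖F (diagPoint (n + 1) p.1 - p.2 - w)‖ₑ) ∂(volume.prod ν) := by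
        refine lintegral_mono fun w => ?_
        rw [lintegral_const_mul' _ _ ENNReal.ofReal_ne_top, enorm_mul]
        have e : ‖(gaussDensity τ w : ℂ)‖ₑ = ENNReal.ofReal (gaussDensity τ w) := by
          rw [← ofReal_norm, Complex.norm_real, Real.norm_eq_abs,
            abs_of_nonneg (gaussDensity_nonneg hτ w)]
        rw [e]
        gcongr
        refine (enorm_integral_le_lintegral_enorm _).trans_eq (lintegral_congr fun p => ?_)
        rw [enorm_mul]
        congr 1
        rw [← ofReal_norm, Complex.norm_real, ofReal_norm]
    _ = ∫⁻ p : 𝔼 × 𝕎, (∫⁻ w : 𝕎, ENNReal.ofReal (gaussDensity τ w) *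
          (‖h p.1‖ₑ * ‖F (diagPoint (n + 1) p.1 - p.2 - w)‖ₑ)) ∂(volume.prod ν) := by
        refine lintegral_lintegral_swap (Measurable.aemeasurable ?_)
        exact (hgm.comp measurable_fst).mul ((hhm.comp (measurable_fst.comp measurable_snd)).mul
          (hFm.comp ((hT.comp measurable_snd).sub measurable_fst)))
    _ = ∫⁻ p : 𝔼 × 𝕎, (‖h p.1‖ₑ * ∫⁻ v : 𝕎, ‖F v‖ₑ *
          ENNReal.ofReal (gaussDensity τ (diagPoint (n + 1) p.1 - v - p.2))) ∂(volume.prod ν) := by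
        refine lintegral_congr fun p => ?_
        rw [← lintegral_sub_left_eq_self _ (diagPoint (n + 1) p.1 - p.2),
          ← lintegral_const_mul]
        · refine lintegral_congr fun v => ?_
          rw [sub_sub_cancel, sub_right_comm]
          ring
        · exact hFm.mul (hgm.comp ((measurable_const.sub measurable_id).sub_const _))
    _ = ∫⁻ x : 𝔼, ∫⁻ u : 𝕎, (‖h x‖ₑ * ∫⁻ v : 𝕎, ‖F v‖ₑ *
          ENNReal.ofReal (gaussDensity τ (diagPoint (n + 1) x - v - u))) ∂ν := by
        rw [lintegral_prod]
        refine ((hhm.comp measurable_fst).mul (Measurable.lintegral_prod_right' (ν := volume)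
          (f := fun q : (𝔼 × 𝕎) × 𝕎 => ‖F q.2‖ₑ *
            ENNReal.ofReal (gaussDensity τ (diagPoint (n + 1) q.1.1 - q.2 - q.1.2)))
          ?_)).aemeasurable
        refine (hFm.comp measurable_snd).mul (hgm.comp ?_)
        exact ((continuous_diagPoint.measurable.comp (measurable_fst.comp measurable_fst)).sub
          measurable_snd).sub (measurable_snd.comp measurable_fst)
    _ ≤ ∫⁻ x : 𝔼, ‖h x‖ₑ * ∫⁻ v : 𝕎, ‖F v‖ₑ * ENNReal.ofReal (K / √τ) := by
        refine lintegral_mono fun x => ?_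
        have hm : Measurable fun q : 𝕎 × 𝕎 => ‖F q.2‖ₑ *
            ENNReal.ofReal (gaussDensity τ (diagPoint (n + 1) x - q.2 - q.1)) :=
          (hFm.comp measurable_snd).mul
            (hgm.comp ((measurable_const.sub measurable_snd).sub measurable_fst))
        rw [lintegral_const_mul _ hm.lintegral_prod_right', lintegral_lintegral_swap hm.aemeasurable]
        gcongr with v
        simp only
        rw [lintegral_const_mul]
        · gcongr
          exact hK τ hτ _
        · exact hgm.comp (measurable_const.sub measurable_id)
    _ = _ := by
        rw [lintegral_mul_const _ hFm, lintegral_mul_const _ hhm, lintegral_enorm_tensorFun hf]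
        ring

theorem continuous_fourier_of_integrable {V : Type*} [NormedAddCommGroup V]
    [InnerProductSpace ℝ V] [FiniteDimensional ℝ V] [MeasurableSpace V] [BorelSpace V]
    {g : V → ℂ} (hg : Integrable g) : Continuous (𝓕 g) :=
  VectorFourier.fourierIntegral_continuous Real.continuous_fourierChar
    (by exact continuous_inner) hg

theorem continuous_fourier_unitSphereMeasure :
    Continuous fun ξ : 𝕎 => ∫ u, (Real.fourierChar ⟪u, ξ⟫ : ℂ) ∂(unitSphereMeasure 𝕎) := by
  refine continuous_of_dominated (bound := fun _ => 1) (fun ξ => ?_) (fun ξ => ?_)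
    (integrable_const 1) (ae_of_all _ fun u => ?_)
  · exact Continuous.aestronglyMeasurable (by fun_prop)
  · exact ae_of_all _ fun u => (Circle.norm_coe _).le
  · fun_prop

/-- Distributes the decay in ξ over all blocks but the first, which is kept free to integrate the
transform of h in ∑ ξ^j. -/
theorem prod_max_rpow_le_max_rpow {β L : ℝ} (hβ : 0 ≤ β) (hL : 0 < L) (ξ : 𝕎) :
    ∏ j : Fin n, max L ‖block j.succ ξ‖ ^ β ≤ max L ‖ξ‖ ^ (β * n) := by
  have hp : 0 < max L ‖ξ‖ := hL.trans_le (le_max_left _ _)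
  calc ∏ j : Fin n, max L ‖block j.succ ξ‖ ^ β ≤ ∏ _j : Fin n, max L ‖ξ‖ ^ β := by
        refine Finset.prod_le_prod (fun j _ => by positivity) fun j _ => ?_
        gcongr
        exact norm_block_le _ _
    _ = _ := by
        rw [Finset.prod_const, Finset.card_univ, Fintype.card_fin, ← Real.rpow_natCast,
          ← Real.rpow_mul hp.le]

/-- Cauchy–Schwarz bound for the Fourier transform of the form against a multiplier. -/
theorem lintegral_enorm_mul_fourier_formTranslate_le {h : 𝔼 → ℝ} {f : Fin (n + 1) → 𝔼 → ℝ}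
    (hh : Continuous h) (hhc : HasCompactSupport h) (hf : ∀ j, Continuous (f j))
    (hc : ∀ j, HasCompactSupport (f j)) {B : 𝕎 → ℝ} (hB : Continuous B) {C L β : ℝ} (hL : 0 < L)
    (hβ : 0 ≤ β)
    (hBC : ∀ ξ, ‖∫ u, (Real.fourierChar ⟪u, ξ⟫ : ℂ) ∂(unitSphereMeasure 𝕎)‖ ^ 2 * B ξ ^ 2 *
      max L ‖ξ‖ ^ (β * n) ≤ C) :
    ∫⁻ ξ, ‖B ξ‖ₑ * ‖𝓕 (formTranslate h f) ξ‖ₑ ≤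
      (ENNReal.ofReal C * (ENNReal.ofReal (∫ x, h x ^ 2) *
        (∫⁻ ζ : 𝔼, ENNReal.ofReal (max L ‖ζ‖ ^ (-β))) ^ n)) ^ (1 / 2 : ℝ) *
      (∏ j, ENNReal.ofReal (∫ x, f j x ^ 2)) ^ (1 / 2 : ℝ) := by
  set hC : 𝔼 → ℂ := fun x => (h x : ℂ) with hhC
  set fC : Fin (n + 1) → 𝔼 → ℂ := fun j x => (f j x : ℂ) with hfC
  set νh : 𝕎 → ℂ := fun ξ => ∫ u, (Real.fourierChar ⟪u, ξ⟫ : ℂ) ∂(unitSphereMeasure 𝕎) with hνh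
  have hνc : Continuous νh := continuous_fourier_unitSphereMeasure
  have hHc : Continuous (𝓕 hC) :=
    continuous_fourier_of_integrable (hh.integrable_of_hasCompactSupport hhc).ofReal
  have hFc : ∀ j, Continuous (𝓕 (fC j)) := fun j =>
    continuous_fourier_of_integrable ((hf j).integrable_of_hasCompactSupport (hc j)).ofReal
  have hsumc : Continuous fun ξ : 𝕎 => ∑ j, block j ξ :=
    continuous_finsetSum _ fun j _ => continuous_block j
  -- Cauchy–Schwarz between the tensor product G2, handled by Plancherel in each block, and the rest
  -- G1. The hypothesis on B turns the decay in G1² into n block weights, so that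
  -- `lintegral_sum_mul_prod_tail` applies.
  set G1 : 𝕎 → ℝ≥0∞ := fun ξ => ‖B ξ‖ₑ * ‖νh ξ‖ₑ * ‖𝓕 hC (∑ j, block j ξ)‖ₑ with hG1
  set G2 : 𝕎 → ℝ≥0∞ := fun ξ => ∏ j, ‖𝓕 (fC j) (-block j ξ)‖ₑ with hG2
  have hG1m : Measurable G1 :=
    (hB.measurable.enorm.mul hνc.measurable.enorm).mul (hHc.comp hsumc).measurable.enorm
  have hG2m : Measurable G2 :=
    Finset.measurable_prod _ fun j _ => ((hFc j).comp (continuous_block j).neg).measurable.enorm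
  have hG1sq : ∫⁻ ξ, G1 ξ ^ (2 : ℝ) ≤ ENNReal.ofReal C * (ENNReal.ofReal (∫ x, h x ^ 2) *
        (∫⁻ ζ : 𝔼, ENNReal.ofReal (max L ‖ζ‖ ^ (-β))) ^ n) := by
    have hwm : Measurable fun ζ : 𝔼 => ENNReal.ofReal (max L ‖ζ‖ ^ (-β)) := by fun_prop
    have hHm : Measurable fun η : 𝔼 => ‖𝓕 hC η‖ₑ ^ 2 := hHc.measurable.enorm.pow_const 2
    calc ∫⁻ ξ, G1 ξ ^ (2 : ℝ) ≤ ∫⁻ ξ : 𝕎, ENNReal.ofReal C * (‖𝓕 hC (∑ j, block j ξ)‖ₑ ^ 2 *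
          ∏ j : Fin n, ENNReal.ofReal (max L ‖block j.succ ξ‖ ^ (-β))) := by
          refine lintegral_mono fun ξ => ?_
          rw [ENNReal.rpow_two, hG1]
          simp only
          rw [mul_pow, mul_comm, mul_left_comm]
          gcongr
          rw [← ENNReal.ofReal_prod_of_nonneg fun j _ => by positivity,
            ← ENNReal.ofReal_mul' (Finset.prod_nonneg fun j _ => by positivity),
            ← ofReal_norm, ← ofReal_norm, ← ENNReal.ofReal_mul (norm_nonneg _),
            ← ENNReal.ofReal_pow (by positivity)]
          refine ENNReal.ofReal_le_ofReal ?_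
          have hpos : 0 < ∏ j : Fin n, max L ‖block j.succ ξ‖ ^ β :=
            Finset.prod_pos fun j _ => Real.rpow_pos_of_pos (hL.trans_le (le_max_left _ _)) _
          have hinv : ∏ j : Fin n, max L ‖block j.succ ξ‖ ^ (-β) =
              (∏ j : Fin n, max L ‖block j.succ ξ‖ ^ β)⁻¹ := by
            rw [← Finset.prod_inv_distrib]
            exact Finset.prod_congr rfl fun j _ =>
              Real.rpow_neg (hL.le.trans (le_max_left _ _)) _
          rw [hinv, ← div_eq_mul_inv, le_div_iff₀ hpos]
          refine le_trans ?_ (hBC ξ)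
          rw [mul_pow, Real.norm_eq_abs, sq_abs, mul_comm (B ξ ^ 2)]
          gcongr
          exact prod_max_rpow_le_max_rpow hβ hL ξ
      _ = ENNReal.ofReal C * ∫⁻ y : Fin (n + 1) → 𝔼, ‖𝓕 hC (∑ j, y j)‖ₑ ^ 2 *
          ∏ j : Fin n, ENNReal.ofReal (max L ‖y j.succ‖ ^ (-β)) := by
          rw [lintegral_const_mul' _ _ ENNReal.ofReal_ne_top]
          congr 1
          exact measurePreserving_blockEquiv.lintegral_comp_emb
            (MeasurableEquiv.measurableEmbedding _) (fun y : Fin (n + 1) → 𝔼 =>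
              ‖𝓕 hC (∑ j, y j)‖ₑ ^ 2 * ∏ j : Fin n, ENNReal.ofReal (max L ‖y j.succ‖ ^ (-β)))
      _ = ENNReal.ofReal C * ((∫⁻ η, ‖𝓕 hC η‖ₑ ^ 2) *
          (∫⁻ ζ : 𝔼, ENNReal.ofReal (max L ‖ζ‖ ^ (-β))) ^ n) := by
          rw [lintegral_sum_mul_prod_tail hHm hwm]
      _ ≤ _ := by
          gcongr
          exact lintegral_enorm_fourier_sq_le hh hhc
  have hG2sq : ∫⁻ ξ, G2 ξ ^ (2 : ℝ) ≤ ∏ j, ENNReal.ofReal (∫ x, f j x ^ 2) := by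
    calc ∫⁻ ξ, G2 ξ ^ (2 : ℝ) = ∫⁻ ξ : 𝕎, ∏ j, ‖𝓕 (fC j) (-block j ξ)‖ₑ ^ 2 := by
          refine lintegral_congr fun ξ => ?_
          rw [ENNReal.rpow_two, hG2, Finset.prod_pow]
      _ = ∏ j, ∫⁻ x, ‖𝓕 (fC j) (-x)‖ₑ ^ 2 :=
          lintegral_prod_block (fun j x => ‖𝓕 (fC j) (-x)‖ₑ ^ 2) fun j =>
            (((hFc j).comp continuous_neg).measurable.enorm.pow_const 2)
      _ ≤ _ := by
          refine Finset.prod_le_prod' fun j _ => ?_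
          rw [lintegral_neg_eq_self (fun x => ‖𝓕 (fC j) x‖ₑ ^ 2)]
          exact lintegral_enorm_fourier_sq_le (hf j) (hc j)
  calc ∫⁻ ξ, ‖B ξ‖ₑ * ‖𝓕 (formTranslate h f) ξ‖ₑ = ∫⁻ ξ, (G1 * G2) ξ := by
        refine lintegral_congr fun ξ => ?_
        rw [fourier_formTranslate hh hhc hf hc, enorm_mul, enorm_mul, Pi.mul_apply, hG1, hG2]
        have : ‖∏ j, 𝓕 (fun x => (f j x : ℂ)) (-block j ξ)‖ₑ =
            ∏ j, ‖𝓕 (fC j) (-block j ξ)‖ₑ := by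
          simp [enorm_eq_nnnorm, nnnorm_prod, hfC]
        rw [this]
        simp only [hνh, hhC]
        ring
    _ ≤ (∫⁻ ξ, G1 ξ ^ (2 : ℝ)) ^ (1 / 2 : ℝ) * (∫⁻ ξ, G2 ξ ^ (2 : ℝ)) ^ (1 / 2 : ℝ) :=
        ENNReal.lintegral_mul_le_Lp_mul_Lq _ Real.HolderConjugate.two_two
          hG1m.aemeasurable hG2m.aemeasurable
    _ ≤ _ := by gcongr

end FormBounds

/-! ### Splitting the frequency integral at scale L. -/

section FormSplit

open FourierTransform
open scoped RealInnerProductSpace ENNReal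

variable {n d : ℕ}

local notation "𝔼" => EuclideanSpace ℝ (Fin d)
local notation "𝕎" => EuclideanSpace ℝ (Fin (n + 1) × Fin d)

theorem one_sub_exp_pow_eq (N : ℕ) (s : ℝ) :
    (1 - Real.exp (-s)) ^ N = 1 + ∑ k ∈ Finset.range N,
      (-1) ^ (k + 1) * (N.choose (k + 1) : ℝ) * Real.exp (-((k + 1 : ℕ) * s)) := by
  rw [show 1 - Real.exp (-s) = -Real.exp (-s) + 1 by ring, add_pow, Finset.sum_range_succ']
  simp only [one_pow, mul_one, pow_zero, Nat.choose_zero_right, Nat.cast_one]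
  rw [add_comm]
  congr 1
  refine Finset.sum_congr rfl fun k _ => ?_
  rw [neg_pow, ← Real.exp_nat_mul]
  ring_nf

/-- The multiplier is at most 1 for r ≥ L, while for r ≤ L its base is at most (r / L)² ≤ r / L. It
thus upgrades decay in ‖ξ‖ to decay in max L ‖ξ‖. -/
theorem sq_one_sub_exp_pow_mul_max_le {L r : ℝ} (hL : 0 < L) (hr : 0 ≤ r) (N : ℕ) :
    ((1 - Real.exp (-(1 / L ^ 2 * r ^ 2))) ^ N) ^ 2 * max L r ^ N ≤ r ^ N := by
  set b := 1 - Real.exp (-(1 / L ^ 2 * r ^ 2)) with hb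
  have hb0 : 0 ≤ b := by
    have : Real.exp (-(1 / L ^ 2 * r ^ 2)) ≤ 1 := Real.exp_le_one_iff.2 (by
      have : 0 ≤ 1 / L ^ 2 * r ^ 2 := by positivity
      linarith)
    linarith
  have hb1 : b ≤ 1 := by linarith [Real.exp_pos (-(1 / L ^ 2 * r ^ 2))]
  rcases le_total L r with h | h
  · rw [max_eq_right h]
    exact mul_le_of_le_one_left (by positivity) (pow_le_one₀ (by positivity) (pow_le_one₀ hb0 hb1))
  · rw [max_eq_left h]
    have hy : r / L ≤ 1 := (div_le_one hL).2 h
    have hbr : b ≤ r / L := by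
      have h1 : b ≤ (r / L) ^ 2 := by
        have := Real.add_one_le_exp (-(1 / L ^ 2 * r ^ 2))
        rw [div_pow]
        have e : r ^ 2 / L ^ 2 = 1 / L ^ 2 * r ^ 2 := by ring
        linarith
      have h2 : 0 ≤ r / L := by positivity
      nlinarith
    have hb2 : b ^ 2 ≤ r / L := by nlinarith
    calc (b ^ N) ^ 2 * L ^ N = (b ^ 2 * L) ^ N := by rw [mul_pow, pow_right_comm]
      _ ≤ (r / L * L) ^ N := by gcongr
      _ = r ^ N := by rw [div_mul_cancel₀ _ hL.ne']

theorem integrable_and_bound_fourier_formTranslate (hd : 2 ≤ d) (hn : 1 ≤ n) :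
    ∃ C : ℝ, 0 ≤ C ∧ ∀ (h : 𝔼 → ℝ) (f : Fin (n + 1) → 𝔼 → ℝ), Continuous h →
      HasCompactSupport h → (∀ j, Continuous (f j)) → (∀ j, HasCompactSupport (f j)) →
      Integrable (𝓕 (formTranslate h f)) ∧ ∀ L : ℝ, 0 < L →
      ∫⁻ ξ : 𝕎, ‖(1 - Real.exp (-(1 / L ^ 2 * ‖ξ‖ ^ 2))) ^ ((n + 1) * d - 1)‖ₑ *
          ‖𝓕 (formTranslate h f) ξ‖ₑ ≤
        ENNReal.ofReal (C * L ^ ((1 - d : ℝ) / 2)) * (ENNReal.ofReal (∫ x, h x ^ 2) *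
          ∏ j, ENNReal.ofReal (∫ x, f j x ^ 2)) ^ (1 / 2 : ℝ) := by
  have : NeZero d := ⟨by omega⟩
  set N : ℕ := (n + 1) * d - 1 with hN
  have hN1 : 1 ≤ (n + 1) * d := Nat.mul_pos (by omega) (by omega)
  have hNr : (N : ℝ) = (n + 1) * d - 1 := by rw [hN, Nat.cast_sub hN1]; push_cast; ring
  have hnr : (1 : ℝ) ≤ n := by exact_mod_cast hn
  have hdr : (2 : ℝ) ≤ d := by exact_mod_cast hd
  -- The decay exponent N = md - 1 is shared equally among n blocks. Then β > d amounts to d > 1,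
  -- and the n block integrals contribute L^{n(d - β)} = L^{1 - d}, before the square root.
  set β : ℝ := N / n with hβ
  have hβn : β * n = N := by rw [hβ]; field_simp
  have hβ0 : 0 ≤ β := by positivity
  have hβd : (Module.finrank ℝ 𝔼 : ℝ) < β := by
    rw [finrank_euclideanSpace, Fintype.card_fin, hβ, lt_div_iff₀ (by linarith), hNr]
    nlinarith
  obtain ⟨C₀, hC₀, hdecay⟩ := exists_norm_fourier_unitSphere_le (ι := Fin (n + 1) × Fin d)
  have hcard : Fintype.card (Fin (n + 1) × Fin d) - 1 = N := by simp [hN]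
  rw [hcard] at hdecay
  obtain ⟨Cw, hCw, hweight⟩ := exists_lintegral_max_rpow_le (V := 𝔼) hβd
  set M : ℝ := (unitSphereMeasure 𝕎).real Set.univ
  have hM : ∀ ξ : 𝕎, ‖∫ u, (Real.fourierChar ⟪u, ξ⟫ : ℂ) ∂(unitSphereMeasure 𝕎)‖ ≤ M := by
    intro ξ
    have := norm_integral_le_of_norm_le_const (μ := unitSphereMeasure 𝕎) (C := 1)
      (f := fun u => (Real.fourierChar ⟪u, ξ⟫ : ℂ)) (ae_of_all _ fun u => (Circle.norm_coe _).le)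
    simpa using this
  refine ⟨√(C₀ * Cw ^ n), by positivity, fun h f hh hhc hf hc => ⟨?_, fun L hL => ?_⟩⟩
  · have hi : Integrable (formTranslate h f) := integrable_correlation (integrable_fst_form hh hhc)
      measurable_diagPoint_sub (continuous_tensorFun hf) (integrable_tensorFun hf hc)
    refine ⟨(continuous_fourier_of_integrable hi).aestronglyMeasurable, ?_⟩
    rw [hasFiniteIntegral_iff_enorm]
    -- The multiplier 1 with L = 1 gives the integrability that Fourier inversion needs.
    have hb := lintegral_enorm_mul_fourier_formTranslate_le hh hhc hf hc
      (B := fun _ => 1) continuous_const (C := C₀ + M ^ 2) (L := 1) one_pos hβ0 (fun ξ => by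
        rw [hβn, Real.rpow_natCast, one_pow, mul_one]
        rcases le_total 1 ‖ξ‖ with h1 | h1
        · rw [max_eq_right h1]; linarith [hdecay ξ, sq_nonneg M]
        · rw [max_eq_left h1, one_pow, mul_one]
          have := pow_le_pow_left₀ (norm_nonneg _) (hM ξ) 2
          linarith)
    simp only [enorm_one, one_mul] at hb
    refine hb.trans_lt (ENNReal.mul_lt_top ?_ ?_)
    · refine ENNReal.rpow_lt_top_of_nonneg (by norm_num) (ENNReal.mul_ne_top ENNReal.ofReal_ne_top
        (ENNReal.mul_ne_top ENNReal.ofReal_ne_top (ENNReal.pow_ne_top ?_)))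
      exact ((hweight 1 one_pos).trans_lt ENNReal.ofReal_lt_top).ne
    · exact ENNReal.rpow_lt_top_of_nonneg (by norm_num)
        (ENNReal.prod_lt_top fun j _ => ENNReal.ofReal_lt_top).ne
  · have hb := lintegral_enorm_mul_fourier_formTranslate_le hh hhc hf hc
      (B := fun ξ => (1 - Real.exp (-(1 / L ^ 2 * ‖ξ‖ ^ 2))) ^ N) (by fun_prop)
      (C := C₀) hL hβ0 (fun ξ => by
        rw [hβn, Real.rpow_natCast, mul_assoc]
        refine le_trans ?_ (hdecay ξ)
        gcongr
        exact sq_one_sub_exp_pow_mul_max_le hL (norm_nonneg _) N)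
    refine hb.trans ?_
    have hI : (∫⁻ ζ : 𝔼, ENNReal.ofReal (max L ‖ζ‖ ^ (-β))) ^ n ≤
        ENNReal.ofReal (Cw ^ n * L ^ (1 - d : ℝ)) := by
      refine (pow_le_pow_left₀ zero_le (hweight L hL) n).trans_eq ?_
      rw [← ENNReal.ofReal_pow (by positivity), mul_pow, ← Real.rpow_natCast (L ^ _),
        ← Real.rpow_mul hL.le, finrank_euclideanSpace, Fintype.card_fin, sub_mul, hβn, hNr]
      congr 3
      ring
    have hhalf : (0 : ℝ) ≤ 1 / 2 := by norm_num
    have hsq : ENNReal.ofReal (√(C₀ * Cw ^ n) * L ^ ((1 - d : ℝ) / 2)) =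
        (ENNReal.ofReal (C₀ * (Cw ^ n * L ^ (1 - d : ℝ)))) ^ (1 / 2 : ℝ) := by
      rw [ENNReal.ofReal_rpow_of_nonneg (by positivity) hhalf, ← mul_assoc,
        Real.mul_rpow (by positivity) (by positivity), Real.sqrt_eq_rpow, ← Real.rpow_mul hL.le]
      ring_nf
    rw [hsq, ← ENNReal.mul_rpow_of_nonneg _ _ hhalf, ← ENNReal.mul_rpow_of_nonneg _ _ hhalf]
    refine ENNReal.rpow_le_rpow ?_ hhalf
    rw [ENNReal.ofReal_mul hC₀]
    calc _ ≤ ENNReal.ofReal C₀ * (ENNReal.ofReal (∫ x, h x ^ 2) *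
          ENNReal.ofReal (Cw ^ n * L ^ (1 - d : ℝ))) * ∏ j, ENNReal.ofReal (∫ x, f j x ^ 2) := by
          gcongr
      _ = _ := by ring

/-- The basic estimate: a low frequency `L¹` part and a high frequency `L²` part. -/
theorem exists_enorm_formTranslate_zero_le (hd : 2 ≤ d) (hn : 1 ≤ n) :
    ∃ C : ℝ, 0 ≤ C ∧ ∀ (h : 𝔼 → ℝ) (f : Fin (n + 1) → 𝔼 → ℝ), Continuous h →
      HasCompactSupport h → (∀ j, Continuous (f j)) → (∀ j, HasCompactSupport (f j)) →
      ∀ L : ℝ, 0 < L → ‖formTranslate h f 0‖ₑ ≤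
        ENNReal.ofReal (C * L) * ((∫⁻ x, ‖h x‖ₑ) * ∏ j, ∫⁻ x, ‖f j x‖ₑ) +
        ENNReal.ofReal (C * L ^ ((1 - d : ℝ) / 2)) * (ENNReal.ofReal (∫ x, h x ^ 2) *
          ∏ j, ENNReal.ofReal (∫ x, f j x ^ 2)) ^ (1 / 2 : ℝ) := by
  obtain ⟨C₁, hC₁, hhigh⟩ := integrable_and_bound_fourier_formTranslate hd hn
  obtain ⟨K, hK, hlow⟩ := exists_enorm_integral_gaussDensity_mul_formTranslate_le (n := n)
    (d := d) (by omega)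
  set N : ℕ := (n + 1) * d - 1
  set S : ℝ := ∑ k ∈ Finset.range N, (N.choose (k + 1) : ℝ) with hS
  have hS0 : 0 ≤ S := by positivity
  refine ⟨C₁ + S * K, by positivity, fun h f hh hhc hf hc L hL => ?_⟩
  obtain ⟨hFi, hb⟩ := hhigh h f hh hhc hf hc
  specialize hb L hL
  set Φ := formTranslate h f with hΦ
  set P := (∫⁻ x, ‖h x‖ₑ) * ∏ j, ∫⁻ x, ‖f j x‖ₑ with hP
  obtain ⟨Mf, hMf⟩ := exists_norm_tensorFun_le hf hc
  have hi : Integrable Φ := integrable_correlation (integrable_fst_form hh hhc)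
      measurable_diagPoint_sub (continuous_tensorFun hf) (integrable_tensorFun hf hc)
  have hcont : Continuous Φ := continuous_correlation (integrable_fst_form hh hhc)
      measurable_diagPoint_sub (continuous_tensorFun hf) hMf
  have hinv : Φ 0 = ∫ ξ, 𝓕 Φ ξ := by
    have := congrFun (hcont.fourierInv_fourier_eq hi hFi) 0
    rw [Real.fourierInv_eq] at this
    simpa using this.symm
  have hexpi : ∀ τ : ℝ, 0 < τ → Integrable fun ξ : 𝕎 =>
      ((Real.exp (-τ * ‖ξ‖ ^ 2) : ℝ) : ℂ) * 𝓕 Φ ξ := fun τ hτ => by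
    refine hFi.bdd_mul (c := 1) (by fun_prop) (ae_of_all _ fun ξ => ?_)
    rw [Complex.norm_real, Real.norm_eq_abs, Real.abs_exp]
    exact Real.exp_le_one_iff.2 (by nlinarith [sq_nonneg ‖ξ‖])
  set b : 𝕎 → ℝ := fun ξ => (1 - Real.exp (-(1 / L ^ 2 * ‖ξ‖ ^ 2))) ^ N with hbdef
  set τ : ℕ → ℝ := fun k => ((k + 1 : ℕ) : ℝ) * (1 / L ^ 2) with hτ
  have hτ0 : ∀ k, 0 < τ k := fun k => by positivity
  -- In the binomial expansion of b the constant term is 1, so 1 - b is a combination of Gaussians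
  -- with parameters τ k = (k + 1) / L². Each satisfies 1 / √(τ k) ≤ L, so each low-frequency term
  -- costs at most K * L.
  have hsplit : ∀ ξ, 𝓕 Φ ξ = (b ξ : ℂ) * 𝓕 Φ ξ - ∑ k ∈ Finset.range N,
      (((-1) ^ (k + 1) * (N.choose (k + 1) : ℝ) : ℝ) : ℂ) *
        (((Real.exp (-τ k * ‖ξ‖ ^ 2) : ℝ) : ℂ) * 𝓕 Φ ξ) := by
    intro ξ
    have e : (b ξ : ℂ) = 1 + ∑ k ∈ Finset.range N,
      (((-1) ^ (k + 1) * (N.choose (k + 1) : ℝ) : ℝ) : ℂ) *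
        ((Real.exp (-τ k * ‖ξ‖ ^ 2) : ℝ) : ℂ) := by
      rw [hbdef]
      simp only
      rw [one_sub_exp_pow_eq]
      push_cast
      congr 1
      refine Finset.sum_congr rfl fun k _ => ?_
      simp only [hτ]
      push_cast
      ring_nf
    rw [e, add_mul, Finset.sum_mul, one_mul]
    simp only [mul_assoc, add_sub_cancel_right]
  have hsumi : ∀ k ∈ Finset.range N, Integrable fun ξ : 𝕎 =>
      (((-1) ^ (k + 1) * (N.choose (k + 1) : ℝ) : ℝ) : ℂ) *
        (((Real.exp (-τ k * ‖ξ‖ ^ 2) : ℝ) : ℂ) * 𝓕 Φ ξ) := fun k _ =>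
    (hexpi _ (hτ0 k)).const_mul _
  have hbi : Integrable fun ξ : 𝕎 => (b ξ : ℂ) * 𝓕 Φ ξ := by
    refine (hFi.add (integrable_finsetSum _ hsumi)).congr (ae_of_all _ fun ξ => ?_)
    simp only [Pi.add_apply]
    nth_rewrite 1 [hsplit ξ]
    ring
  have hint : ∫ ξ, 𝓕 Φ ξ = (∫ ξ, (b ξ : ℂ) * 𝓕 Φ ξ) - ∑ k ∈ Finset.range N,
      (((-1) ^ (k + 1) * (N.choose (k + 1) : ℝ) : ℝ) : ℂ) *
        ∫ w, (gaussDensity (τ k) w : ℂ) * Φ w := by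
    calc ∫ ξ, 𝓕 Φ ξ = ∫ ξ, ((b ξ : ℂ) * 𝓕 Φ ξ - ∑ k ∈ Finset.range N,
      (((-1) ^ (k + 1) * (N.choose (k + 1) : ℝ) : ℝ) : ℂ) *
        (((Real.exp (-τ k * ‖ξ‖ ^ 2) : ℝ) : ℂ) * 𝓕 Φ ξ)) := integral_congr_ae (ae_of_all _ hsplit)
      _ = _ := by
        rw [integral_sub hbi (integrable_finsetSum _ hsumi), integral_finsetSum _ hsumi]
        congr 1
        refine Finset.sum_congr rfl fun k _ => ?_
        rw [integral_const_mul, integral_gaussDensity_mul (hτ0 k) hi]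
  have hK' : ∀ k, ‖∫ w, (gaussDensity (τ k) w : ℂ) * Φ w‖ₑ ≤ ENNReal.ofReal (K * L) * P := by
    intro k
    refine (hlow (τ k) (hτ0 k) h f hh hf).trans ?_
    gcongr
    rw [div_eq_mul_inv]
    gcongr
    rw [← Real.sqrt_inv, Real.sqrt_le_left hL.le]
    simp only [hτ, one_div, mul_inv, inv_inv]
    refine mul_le_of_le_one_left (by positivity) (inv_le_one_of_one_le₀ ?_)
    exact_mod_cast Nat.le_add_left 1 k
  rw [hinv, hint]
  calc _ ≤ ‖∫ ξ, (b ξ : ℂ) * 𝓕 Φ ξ‖ₑ + ‖∑ k ∈ Finset.range N,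
      (((-1) ^ (k + 1) * (N.choose (k + 1) : ℝ) : ℝ) : ℂ) *
        ∫ w, (gaussDensity (τ k) w : ℂ) * Φ w‖ₑ := enorm_sub_le
    _ ≤ (∫⁻ ξ, ‖b ξ‖ₑ * ‖𝓕 Φ ξ‖ₑ) + ∑ k ∈ Finset.range N,
        ENNReal.ofReal (N.choose (k + 1)) * (ENNReal.ofReal (K * L) * P) := by
        gcongr
        · refine (enorm_integral_le_lintegral_enorm _).trans_eq (lintegral_congr fun ξ => ?_)
          rw [enorm_mul]
          congr 1
          rw [← ofReal_norm, Complex.norm_real, ofReal_norm]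
        · refine (enorm_sum_le _ _).trans (Finset.sum_le_sum fun k _ => ?_)
          rw [enorm_mul]
          gcongr
          · rw [← ofReal_norm, Complex.norm_real, norm_mul, norm_pow, norm_neg, norm_one, one_pow,
              one_mul, Real.norm_eq_abs, abs_of_nonneg (Nat.cast_nonneg _)]
          · exact hK' k
    _ ≤ ENNReal.ofReal (C₁ * L ^ ((1 - d : ℝ) / 2)) * (ENNReal.ofReal (∫ x, h x ^ 2) *
          ∏ j, ENNReal.ofReal (∫ x, f j x ^ 2)) ^ (1 / 2 : ℝ) +
          ENNReal.ofReal (S * K * L) * P := by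
        refine add_le_add hb (le_of_eq ?_)
        rw [← Finset.sum_mul, ← ENNReal.ofReal_sum_of_nonneg fun k _ => Nat.cast_nonneg _,
          ← mul_assoc, ← ENNReal.ofReal_mul hS0, mul_assoc S]
    _ ≤ _ := by
        rw [add_comm]
        have hSK : 0 ≤ S * K := by positivity
        gcongr <;> linarith

end FormSplit

/-! ### The restricted-type estimate. -/

section Restricted

open scoped ENNReal

variable {n d : ℕ}

local notation "𝔼" => EuclideanSpace ℝ (Fin d)
local notation "𝕎" => EuclideanSpace ℝ (Fin (n + 1) × Fin d)

/-- The points `x, x - u^1, …, x - u^m` at which the functions in the form are evaluated. -/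
def formPoint {n d : ℕ} (k : Fin (n + 2))
    (p : EuclideanSpace ℝ (Fin d) × EuclideanSpace ℝ (Fin (n + 1) × Fin d)) :
    EuclideanSpace ℝ (Fin d) :=
  Fin.cons (α := fun _ => EuclideanSpace ℝ (Fin d)) p.1 (fun j => p.1 - block j p.2) k

/-- The `(m+1)`-linear form dual to the spherical average. -/
def sphereForm {n d : ℕ} (g : Fin (n + 2) → EuclideanSpace ℝ (Fin d) → ℝ≥0∞) : ℝ≥0∞ :=
  ∫⁻ p, ∏ k, g k (formPoint k p)
    ∂(volume.prod (unitSphereMeasure (EuclideanSpace ℝ (Fin (n + 1) × Fin d))))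

theorem formPoint_zero (p : 𝔼 × 𝕎) : formPoint 0 p = p.1 := rfl

theorem formPoint_succ (j : Fin (n + 1)) (p : 𝔼 × 𝕎) :
    formPoint j.succ p = p.1 - block j p.2 := rfl

theorem continuous_formPoint (k : Fin (n + 2)) :
    Continuous (formPoint k : 𝔼 × 𝕎 → 𝔼) := by
  refine Fin.cases ?_ (fun j => ?_) k
  · exact continuous_fst
  · exact continuous_fst.sub ((continuous_block j).comp continuous_snd)

theorem sphereForm_const_mul (c : Fin (n + 2) → ℝ≥0∞) (hc : ∀ k, c k ≠ ∞)
    (g : Fin (n + 2) → 𝔼 → ℝ≥0∞) :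
    sphereForm (fun k x => c k * g k x) = (∏ k, c k) * sphereForm g := by
  unfold sphereForm
  rw [← lintegral_const_mul' _ _ (ENNReal.prod_lt_top fun k _ => (hc k).lt_top).ne]
  simp only [Finset.prod_mul_distrib]

theorem sphereForm_sum (s : Fin (n + 2) → Finset ℕ) (g : Fin (n + 2) → ℕ → 𝔼 → ℝ≥0∞)
    (hg : ∀ k l, Measurable (g k l)) :
    sphereForm (fun k x => ∑ l ∈ s k, g k l x) =
      ∑ l ∈ Fintype.piFinset s, sphereForm fun k x => g k (l k) x := by
  unfold sphereForm
  simp only [Finset.prod_univ_sum]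
  refine lintegral_finsetSum _ fun l _ => ?_
  exact Finset.measurable_prod _ fun k _ => (hg k _).comp (continuous_formPoint k).measurable

theorem sphereForm_ofReal_eq {g : Fin (n + 2) → 𝔼 → ℝ} (hg : ∀ k, Continuous (g k))
    (hc : ∀ k, HasCompactSupport (g k)) (h0 : ∀ k x, 0 ≤ g k x) :
    sphereForm (fun k x => ENNReal.ofReal (g k x)) =
      ‖formTranslate (g 0) (fun j => g j.succ) 0‖ₑ := by
  rw [formTranslate_zero, ← ofReal_norm, Complex.norm_real, Real.norm_eq_abs, abs_of_nonneg
    (integral_nonneg fun p => mul_nonneg (h0 _ _) (Finset.prod_nonneg fun j _ => h0 _ _)),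
    ofReal_integral_eq_lintegral_ofReal]
  · refine lintegral_congr fun p => ?_
    rw [Fin.prod_univ_succ, ENNReal.ofReal_mul (h0 _ _),
      ENNReal.ofReal_prod_of_nonneg fun j _ => h0 _ _]
    rfl
  · obtain ⟨M, hM⟩ := exists_norm_tensorFun_le (fun j : Fin (n + 1) => hg j.succ) fun j => hc j.succ
    have hi : Integrable (fun p : 𝔼 × 𝕎 => g 0 p.1) (volume.prod (unitSphereMeasure 𝕎)) :=
      ((hg 0).integrable_of_hasCompactSupport (hc 0)).comp_fst _
    refine hi.mul_bdd (c := M) (Continuous.aestronglyMeasurable ?_) (ae_of_all _ fun p => ?_)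
    · exact continuous_finsetProd _ fun j _ => (hg j.succ).comp
        (continuous_fst.sub ((continuous_block j).comp continuous_snd))
    · have := hM (diagPoint (n + 1) p.1 - p.2)
      simp only [tensorFun, block_sub, block_diagPoint] at this
      rw [← Complex.ofReal_prod, Complex.norm_real] at this
      exact this
  · exact ae_of_all _ fun p => mul_nonneg (h0 _ _) (Finset.prod_nonneg fun j _ => h0 _ _)

/-- Restricted-type estimate at the endpoint exponent `d / (d + 1)`. -/
theorem exists_sphereForm_restricted_le (hd : 2 ≤ d) (hn : 1 ≤ n) :
    ∃ C : ℝ, 0 ≤ C ∧ ∀ g : Fin (n + 2) → 𝔼 → ℝ, (∀ k, Continuous (g k)) →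
      (∀ k, HasCompactSupport (g k)) → (∀ k x, 0 ≤ g k x) → (∀ k x, g k x ≤ 1) →
      sphereForm (fun k x => ENNReal.ofReal (g k x)) ≤
        ENNReal.ofReal C * ∏ k, (∫⁻ x, ENNReal.ofReal (g k x)) ^ ((d : ℝ) / (d + 1)) := by
  obtain ⟨C, hC, hmain⟩ := exists_enorm_formTranslate_zero_le hd hn
  refine ⟨2 * C, by positivity, fun g hg hc h0 h1 => ?_⟩
  have hi : ∀ k, Integrable (g k) := fun k => (hg k).integrable_of_hasCompactSupport (hc k)
  set a : Fin (n + 2) → ℝ := fun k => ∫ x, g k x with ha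
  have ha0 : ∀ k, 0 ≤ a k := fun k => integral_nonneg (h0 k)
  have hlin : ∀ k, ∫⁻ x, ENNReal.ofReal (g k x) = ENNReal.ofReal (a k) := fun k =>
    (ofReal_integral_eq_lintegral_ofReal (hi k) (ae_of_all _ (h0 k))).symm
  have hlin' : ∀ k, ∫⁻ x, ‖g k x‖ₑ = ENNReal.ofReal (a k) := fun k => by
    rw [← hlin]
    exact lintegral_congr fun x => Real.enorm_of_nonneg (h0 k x)
  have hsq : ∀ k, ∫ x, g k x ^ 2 ≤ a k := fun k => by
    refine integral_mono_of_nonneg (ae_of_all _ fun x => sq_nonneg _) (hi k)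
      (ae_of_all _ fun x => ?_)
    simp only
    nlinarith [h0 k x, h1 k x]
  set A : ℝ := ∏ k, a k with hA
  have hAsplit : A = a 0 * ∏ j : Fin (n + 1), a j.succ := Fin.prod_univ_succ a
  have hA0 : 0 ≤ A := Finset.prod_nonneg fun k _ => ha0 k
  have hdr : (2 : ℝ) ≤ d := by exact_mod_cast hd
  have hest : ∀ L : ℝ, 0 < L → sphereForm (fun k x => ENNReal.ofReal (g k x)) ≤
      ENNReal.ofReal (C * (L * A) + C * (L ^ ((1 - d : ℝ) / 2) * A ^ (1 / 2 : ℝ))) := by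
    intro L hL
    rw [sphereForm_ofReal_eq hg hc h0]
    refine (hmain (g 0) (fun j => g j.succ) (hg 0) (hc 0) (fun j => hg _) (fun j => hc _) L
      hL).trans ?_
    rw [ENNReal.ofReal_add (by positivity) (by positivity)]
    refine add_le_add (le_of_eq ?_) ?_
    · simp only [hlin']
      rw [← ENNReal.ofReal_prod_of_nonneg fun j _ => ha0 _, ← ENNReal.ofReal_mul (ha0 0),
        ← ENNReal.ofReal_mul (by positivity), hAsplit, mul_assoc]
    · rw [← mul_assoc, ENNReal.ofReal_mul (p := C * L ^ ((1 - d : ℝ) / 2)) (by positivity)]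
      refine mul_le_mul_right ?_ _
      rw [← ENNReal.ofReal_rpow_of_nonneg hA0 (by norm_num)]
      refine ENNReal.rpow_le_rpow ?_ (by norm_num)
      rw [hAsplit, ENNReal.ofReal_mul (ha0 0),
        ENNReal.ofReal_prod_of_nonneg fun j _ => ha0 _]
      refine mul_le_mul' (ENNReal.ofReal_le_ofReal (hsq 0))
        (Finset.prod_le_prod' fun j _ => ENNReal.ofReal_le_ofReal (hsq j.succ))
  have hrhs : ENNReal.ofReal (2 * C) * ∏ k, (∫⁻ x, ENNReal.ofReal (g k x)) ^ ((d : ℝ) / (d + 1)) =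
      ENNReal.ofReal (2 * C * A ^ ((d : ℝ) / (d + 1))) := by
    simp only [hlin]
    rw [ENNReal.prod_rpow_of_nonneg (by positivity),
      ← ENNReal.ofReal_prod_of_nonneg fun j _ => ha0 _,
      ENNReal.ofReal_rpow_of_nonneg hA0 (by positivity), ← ENNReal.ofReal_mul (by positivity)]
  rw [hrhs]
  rcases hA0.eq_or_lt with h | h
  · refine (hest 1 one_pos).trans (ENNReal.ofReal_le_ofReal ?_)
    rw [← h, Real.zero_rpow (by norm_num), Real.zero_rpow (by positivity)]
    simp
  -- This L solves L A = L^{(1 - d)/2} A^{1/2}, making both terms equal to A^{d/(d+1)}.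
  · refine (hest (A ^ (-(1 / ((d : ℝ) + 1)))) (by positivity)).trans (ENNReal.ofReal_le_ofReal ?_)
    have e1 : A ^ (-(1 / ((d : ℝ) + 1))) * A = A ^ ((d : ℝ) / (d + 1)) := by
      nth_rewrite 2 [← Real.rpow_one A]
      rw [← Real.rpow_add h]
      congr 1
      field_simp
      ring
    have e2 : (A ^ (-(1 / ((d : ℝ) + 1)))) ^ ((1 - d : ℝ) / 2) * A ^ (1 / 2 : ℝ) =
        A ^ ((d : ℝ) / (d + 1)) := by
      rw [← Real.rpow_mul h.le, ← Real.rpow_add h]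
      congr 1
      field_simp
      ring
    rw [e1, e2]
    linarith

end Restricted

/-! ### Dyadic decomposition in height. -/

section Layers

open scoped ENNReal

/-- The `l`-th dyadic layer of a nonnegative function, normalised to take values in `[0, 1]`. -/
def dyadicLayer (l : ℕ) (t : ℝ) : ℝ :=
  if l = 0 then min t 1 else (min t (2 ^ l) - min t (2 ^ (l - 1))) / 2 ^ l

theorem continuous_dyadicLayer (l : ℕ) : Continuous (dyadicLayer l) := by
  unfold dyadicLayer
  split_ifs <;> fun_prop

theorem dyadicLayer_zero (l : ℕ) : dyadicLayer l 0 = 0 := by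
  unfold dyadicLayer
  split_ifs
  · simp
  · rw [min_eq_left (by positivity), min_eq_left (by positivity)]; simp

theorem dyadicLayer_nonneg (l : ℕ) {t : ℝ} (ht : 0 ≤ t) : 0 ≤ dyadicLayer l t := by
  unfold dyadicLayer
  split_ifs
  · exact le_min ht zero_le_one
  · have : (2 : ℝ) ^ (l - 1) ≤ 2 ^ l := pow_le_pow_right₀ (by norm_num) (Nat.sub_le _ _)
    exact div_nonneg (sub_nonneg.2 (min_le_min_left _ this)) (by positivity)

theorem dyadicLayer_le_one (l : ℕ) {t : ℝ} (ht : 0 ≤ t) : dyadicLayer l t ≤ 1 := by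
  unfold dyadicLayer
  split_ifs
  · exact min_le_right _ _
  · rw [div_le_one (by positivity)]
    have : 0 ≤ min t (2 ^ (l - 1)) := le_min ht (by positivity)
    linarith [min_le_right t ((2 : ℝ) ^ l)]

theorem dyadicLayer_succ_eq_zero (l : ℕ) {t : ℝ} (ht : t ≤ 2 ^ l) : dyadicLayer (l + 1) t = 0 := by
  unfold dyadicLayer
  have : (2 : ℝ) ^ l ≤ 2 ^ (l + 1) := pow_le_pow_right₀ (by norm_num) (Nat.le_succ _)
  rw [if_neg (Nat.succ_ne_zero l), Nat.add_sub_cancel, min_eq_left ht,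
    min_eq_left (ht.trans this), sub_self, zero_div]

/-- The differences of truncations telescope; a bounded function is therefore a finite sum of its
weighted layers. -/
theorem sum_dyadicLayer (M : ℕ) (t : ℝ) :
    ∑ l ∈ Finset.range (M + 1), 2 ^ l * dyadicLayer l t = min t (2 ^ M) := by
  induction M with
  | zero => simp [dyadicLayer]
  | succ M ih =>
    rw [Finset.sum_range_succ, ih]
    simp only [dyadicLayer, if_neg (Nat.succ_ne_zero M), Nat.add_sub_cancel]
    field_simp
    ring

variable {X : Type*} [MeasurableSpace X] {μ : Measure X}

/-- For layers of positive index this is Chebyshev's inequality: layer l + 1 is at most 1 and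
vanishes where φ ≤ 2^l. The factor 2^p pays for that index shift. Layer 0 sees all small values of
φ, and only the measure of S controls it. -/
theorem lintegral_dyadicLayer_le {p : ℝ} (hp : 0 < p) {φ : X → ℝ}
    (h0 : ∀ x, 0 ≤ φ x) (h1 : ∫⁻ x, ENNReal.ofReal (φ x) ^ p ∂μ ≤ 1) {S : Set X}
    (hS : MeasurableSet S) (hφS : ∀ x, x ∉ S → φ x = 0) (l : ℕ) :
    ∫⁻ x, ENNReal.ofReal (dyadicLayer l (φ x)) ∂μ ≤
      (μ S + 2 ^ p) * ((2 : ℝ≥0∞) ^ l) ^ (-p) := by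
  rcases l with _ | l
  · rw [pow_zero, ENNReal.one_rpow, mul_one]
    calc _ ≤ ∫⁻ x, S.indicator 1 x ∂μ := by
          refine lintegral_mono fun x => ?_
          by_cases hx : x ∈ S
          · simpa [hx] using dyadicLayer_le_one 0 (h0 x)
          · simp [hx, hφS x hx, dyadicLayer_zero]
      _ = μ S := lintegral_indicator_one hS
      _ ≤ _ := le_self_add
  · have h2 : ((2 : ℝ≥0∞) ^ l) ^ p ≠ 0 := by simp [hp.not_gt]
    have h2' : ((2 : ℝ≥0∞) ^ l) ^ p ≠ ∞ := by simp [hp.not_gt]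
    have hmk : ∫⁻ x, ENNReal.ofReal (dyadicLayer (l + 1) (φ x)) ∂μ ≤ ((2 : ℝ≥0∞) ^ l) ^ (-p) := by
      rw [ENNReal.rpow_neg, ENNReal.le_inv_iff_mul_le, mul_comm, ← lintegral_const_mul']
      · refine (lintegral_mono fun x => ?_).trans h1
        rcases le_total (φ x) (2 ^ l) with h | h
        · simp [dyadicLayer_succ_eq_zero l h]
        · calc _ ≤ ((2 : ℝ≥0∞) ^ l) ^ p * 1 := by
                gcongr
                exact ENNReal.ofReal_le_one.2 (dyadicLayer_le_one _ (h0 x))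
            _ ≤ _ := by
                rw [mul_one]
                gcongr
                rw [ENNReal.le_ofReal_iff_toReal_le (by simp) (h0 x)]
                simpa using h
      · exact h2'
    calc _ ≤ ((2 : ℝ≥0∞) ^ l) ^ (-p) := hmk
      _ = 2 ^ p * ((2 : ℝ≥0∞) ^ (l + 1)) ^ (-p) := by
          rw [pow_succ, ENNReal.mul_rpow_of_ne_top (by simp) (by simp), mul_left_comm,
            ← ENNReal.rpow_add _ _ (by norm_num) (by norm_num), add_neg_cancel, ENNReal.rpow_zero,
            mul_one]
      _ ≤ _ := by gcongr; exact le_add_self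

end Layers

/-! ### From restricted type to strong type, locally and then globally. -/

section StrongType

open scoped ENNReal

variable {n d : ℕ}

local notation "𝔼" => EuclideanSpace ℝ (Fin d)
local notation "𝕎" => EuclideanSpace ℝ (Fin (n + 1) × Fin d)

theorem tsum_two_pow_mul_rpow_ne_top {s : ℝ} (hs : 1 < s) :
    ∑' l : ℕ, (2 : ℝ≥0∞) ^ l * ((2 : ℝ≥0∞) ^ l) ^ (-s) ≠ ∞ := by
  have e : ∀ l : ℕ, (2 : ℝ≥0∞) ^ l * ((2 : ℝ≥0∞) ^ l) ^ (-s) = ((2 : ℝ≥0∞) ^ (1 - s)) ^ l := by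
    intro l
    nth_rewrite 1 [← ENNReal.rpow_one (2 ^ l : ℝ≥0∞)]
    rw [← ENNReal.rpow_add _ _ (by simp) (by simp), ← ENNReal.rpow_natCast, ← ENNReal.rpow_mul,
      ← ENNReal.rpow_natCast, ← ENNReal.rpow_mul, sub_eq_add_neg, mul_comm]
  simp only [e]
  rw [ENNReal.tsum_geometric]
  refine ENNReal.inv_ne_top.2 (tsub_pos_of_lt ?_).ne'
  exact ENNReal.rpow_lt_one_of_one_lt_of_neg (by norm_num) (by linarith)

/-- Multilinear expansion into dyadic layers. The restricted-type bound is a product over the m + 1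
entries, so the sum over all tuples of layers factors into geometric series. -/
theorem exists_sphereForm_le_of_lintegral_le_one (hd : 2 ≤ d) (hn : 1 ≤ n) {p : ℝ}
    (hp : ((d : ℝ) + 1) / d < p) {v : ℝ≥0∞} (hv : v ≠ ∞) :
    ∃ C : ℝ≥0∞, C ≠ ∞ ∧ ∀ g : Fin (n + 2) → 𝔼 → ℝ, (∀ k, Continuous (g k)) →
      (∀ k, HasCompactSupport (g k)) → (∀ k x, 0 ≤ g k x) →
      (∀ k, ∃ S : Set 𝔼, MeasurableSet S ∧ volume S ≤ v ∧ ∀ x, x ∉ S → g k x = 0) →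
      (∀ k, ∫⁻ x, ENNReal.ofReal (g k x) ^ p ≤ 1) →
      sphereForm (fun k x => ENNReal.ofReal (g k x)) ≤ C := by
  obtain ⟨C, hC, hmain⟩ := exists_sphereForm_restricted_le hd hn
  have hdr : (2 : ℝ) ≤ d := by exact_mod_cast hd
  set θ : ℝ := (d : ℝ) / (d + 1) with hθ
  have hθ0 : 0 ≤ θ := by positivity
  have hp0 : 0 < p := lt_trans (by positivity) hp
  -- The ratio of the geometric series is 2^{1 - pθ}; p > (d+1)/d = 1/θ makes it less than 1.
  have hpθ : 1 < p * θ := by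
    have : ((d : ℝ) + 1) / d * θ = 1 := by rw [hθ]; field_simp
    rw [← this]
    exact mul_lt_mul_of_pos_right hp (by positivity)
  set geo : ℝ≥0∞ := ∑' l : ℕ, (2 : ℝ≥0∞) ^ l * ((2 : ℝ≥0∞) ^ l) ^ (-(p * θ)) with hgeo
  have hgeot : geo ≠ ∞ := tsum_two_pow_mul_rpow_ne_top hpθ
  set D : ℝ≥0∞ := (v + 2 ^ p) ^ θ with hD
  have hDt : D ≠ ∞ := ENNReal.rpow_ne_top_of_nonneg hθ0
    (ENNReal.add_ne_top.2 ⟨hv, ENNReal.rpow_ne_top_of_nonneg hp0.le (by simp)⟩)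
  refine ⟨ENNReal.ofReal C * (D * geo) ^ (n + 2), ENNReal.mul_ne_top ENNReal.ofReal_ne_top
    (ENNReal.pow_ne_top (ENNReal.mul_ne_top hDt hgeot)), fun g hg hc h0 hS hN => ?_⟩
  choose M hM using fun k => (hg k).bounded_above_of_compact_support (hc k)
  choose m hm using fun k => pow_unbounded_of_one_lt (M k) (one_lt_two : (1 : ℝ) < 2)
  choose S hSm hSv hS0 using hS
  have hdec : ∀ k x, ENNReal.ofReal (g k x) = ∑ l ∈ Finset.range (m k + 1),
      (2 : ℝ≥0∞) ^ l * ENNReal.ofReal (dyadicLayer l (g k x)) := by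
    intro k x
    have h1 : g k x ≤ 2 ^ m k := ((le_abs_self _).trans (hM k x)).trans (hm k).le
    have h2 := sum_dyadicLayer (m k) (g k x)
    rw [min_eq_left h1] at h2
    nth_rewrite 1 [← h2]
    rw [ENNReal.ofReal_sum_of_nonneg fun l _ =>
      mul_nonneg (by positivity) (dyadicLayer_nonneg l (h0 k x))]
    refine Finset.sum_congr rfl fun l _ => ?_
    rw [ENNReal.ofReal_mul (by positivity), ENNReal.ofReal_pow (by norm_num), ENNReal.ofReal_ofNat]
  have hlayer : ∀ l : Fin (n + 2) → ℕ,
      sphereForm (fun k x => ENNReal.ofReal (dyadicLayer (l k) (g k x))) ≤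
        ENNReal.ofReal C * ∏ k, (D * ((2 : ℝ≥0∞) ^ l k) ^ (-(p * θ))) := by
    intro l
    refine (hmain (fun k x => dyadicLayer (l k) (g k x))
      (fun k => (continuous_dyadicLayer _).comp (hg k))
      (fun k => (hc k).comp_left (dyadicLayer_zero _))
      (fun k x => dyadicLayer_nonneg _ (h0 k x))
      (fun k x => dyadicLayer_le_one _ (h0 k x))).trans ?_
    gcongr with k
    calc _ ≤ ((volume (S k) + 2 ^ p) * ((2 : ℝ≥0∞) ^ l k) ^ (-p)) ^ θ := by
          gcongr
          exact lintegral_dyadicLayer_le hp0 (h0 k) (hN k) (hSm k) (hS0 k) (l k)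
      _ ≤ ((v + 2 ^ p) * ((2 : ℝ≥0∞) ^ l k) ^ (-p)) ^ θ := by gcongr; exact hSv k
      _ = _ := by
          rw [ENNReal.mul_rpow_of_nonneg _ _ hθ0, ← ENNReal.rpow_mul, neg_mul]
  calc sphereForm (fun k x => ENNReal.ofReal (g k x))
      = ∑ l ∈ Fintype.piFinset fun k => Finset.range (m k + 1), sphereForm fun k x =>
          (2 : ℝ≥0∞) ^ l k * ENNReal.ofReal (dyadicLayer (l k) (g k x)) := by
        simp only [hdec]
        exact sphereForm_sum _ (fun k l x => (2 : ℝ≥0∞) ^ l * ENNReal.ofReal (dyadicLayer l (g k x)))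
          fun k l => (((continuous_dyadicLayer l).comp (hg k)).measurable.ennreal_ofReal).const_mul _
    _ ≤ ∑ l ∈ Fintype.piFinset fun k => Finset.range (m k + 1), ENNReal.ofReal C *
          ∏ k, (D * ((2 : ℝ≥0∞) ^ l k * ((2 : ℝ≥0∞) ^ l k) ^ (-(p * θ)))) := by
        refine Finset.sum_le_sum fun l _ => ?_
        rw [sphereForm_const_mul _ fun k => by simp]
        calc _ ≤ (∏ k, (2 : ℝ≥0∞) ^ l k) * (ENNReal.ofReal C *
              ∏ k, (D * ((2 : ℝ≥0∞) ^ l k) ^ (-(p * θ)))) := by gcongr; exact hlayer l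
          _ = _ := by
              rw [mul_left_comm, ← Finset.prod_mul_distrib]
              congr 1
              exact Finset.prod_congr rfl fun k _ => by ring
    _ = ENNReal.ofReal C * ∏ k, ∑ l ∈ Finset.range (m k + 1),
          D * ((2 : ℝ≥0∞) ^ l * ((2 : ℝ≥0∞) ^ l) ^ (-(p * θ))) := by
        rw [← Finset.mul_sum, Finset.prod_univ_sum]
    _ ≤ ENNReal.ofReal C * ∏ _k : Fin (n + 2), (D * geo) := by
        refine mul_le_mul' le_rfl (Finset.prod_le_prod' fun k _ => ?_)
        rw [← Finset.mul_sum]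
        exact mul_le_mul' le_rfl (ENNReal.sum_le_tsum _)
    _ = _ := by simp

/-- Homogeneity: each function is divided by its L^p norm, finite since the function is bounded and
its support has bounded measure. A function of norm zero vanishes by continuity. -/
theorem exists_sphereForm_local_le (hd : 2 ≤ d) (hn : 1 ≤ n) {p : ℝ}
    (hp : ((d : ℝ) + 1) / d < p) {v : ℝ≥0∞} (hv : v ≠ ∞) :
    ∃ C : ℝ≥0∞, C ≠ ∞ ∧ ∀ g : Fin (n + 2) → 𝔼 → ℝ, (∀ k, Continuous (g k)) →
      (∀ k, HasCompactSupport (g k)) → (∀ k x, 0 ≤ g k x) →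
      (∀ k, ∃ S : Set 𝔼, MeasurableSet S ∧ volume S ≤ v ∧ ∀ x, x ∉ S → g k x = 0) →
      sphereForm (fun k x => ENNReal.ofReal (g k x)) ≤
        C * ∏ k, (∫⁻ x, ENNReal.ofReal (g k x) ^ p) ^ (1 / p) := by
  obtain ⟨C, hC, hmain⟩ := exists_sphereForm_le_of_lintegral_le_one (n := n) hd hn hp hv
  have hp0 : 0 < p := lt_trans (by positivity) hp
  refine ⟨C, hC, fun g hg hc h0 hS => ?_⟩
  set N : Fin (n + 2) → ℝ≥0∞ := fun k => ∫⁻ x, ENNReal.ofReal (g k x) ^ p with hN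
  have hNt : ∀ k, N k ≠ ∞ := by
    intro k
    obtain ⟨M, hM⟩ := (hg k).bounded_above_of_compact_support (hc k)
    obtain ⟨S, hSm, hSv, hS0⟩ := hS k
    have : N k ≤ ENNReal.ofReal M ^ p * volume S := by
      rw [← setLIntegral_const, ← lintegral_indicator hSm]
      refine lintegral_mono fun x => ?_
      by_cases hx : x ∈ S
      · simp only [hx, Set.indicator_of_mem]
        gcongr
        exact (le_abs_self _).trans (hM x)
      · simp [hx, hS0 x hx, hp0]
    exact (this.trans_lt (ENNReal.mul_lt_top (ENNReal.rpow_lt_top_of_nonneg hp0.le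
      ENNReal.ofReal_ne_top) (hSv.trans_lt hv.lt_top))).ne
  by_cases hz : ∃ k, N k = 0
  · obtain ⟨k, hk⟩ := hz
    have hgk : g k = 0 := by
      have h1 : (fun x => ENNReal.ofReal (g k x) ^ p) =ᵐ[volume] 0 :=
        (lintegral_eq_zero_iff ((hg k).measurable.ennreal_ofReal.pow_const p)).1 hk
      refine Continuous.ae_eq_iff_eq volume (hg k) continuous_const |>.1 ?_
      filter_upwards [h1] with x hx
      have : ENNReal.ofReal (g k x) = 0 := by
        simpa [ENNReal.rpow_eq_zero_iff, hp0, hp0.not_gt] using hx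
      exact le_antisymm (ENNReal.ofReal_eq_zero.1 this) (h0 k x)
    have : sphereForm (fun k x => ENNReal.ofReal (g k x)) = 0 := by
      unfold sphereForm
      refine (lintegral_congr fun q => ?_).trans lintegral_zero
      exact Finset.prod_eq_zero (Finset.mem_univ k) (by simp [hgk])
    rw [this]
    exact zero_le
  push Not at hz
  set c : Fin (n + 2) → ℝ := fun k => (N k ^ (1 / p)).toReal with hc'
  have hNp : ∀ k, N k ^ (1 / p) ≠ ∞ := fun k =>
    ENNReal.rpow_ne_top_of_nonneg (by positivity) (hNt k)
  have hNp0 : ∀ k, N k ^ (1 / p) ≠ 0 := fun k => by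
    simp [ENNReal.rpow_eq_zero_iff, hz k, hNt k]
  have hcpos : ∀ k, 0 < c k := fun k => ENNReal.toReal_pos (hNp0 k) (hNp k)
  have hofc : ∀ k, ENNReal.ofReal (c k) = N k ^ (1 / p) := fun k => ENNReal.ofReal_toReal (hNp k)
  have hscale : ∀ k x, ENNReal.ofReal (g k x) =
      N k ^ (1 / p) * ENNReal.ofReal ((c k)⁻¹ * g k x) := by
    intro k x
    rw [← hofc, ← ENNReal.ofReal_mul (hcpos k).le, mul_inv_cancel_left₀ (hcpos k).ne']
  have hone : sphereForm (fun k x => ENNReal.ofReal ((c k)⁻¹ * g k x)) ≤ C := by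
    refine hmain (fun k x => (c k)⁻¹ * g k x) (fun k => (hg k).const_mul _)
      (fun k => (hc k).mul_left) (fun k x => mul_nonneg (inv_nonneg.2 (hcpos k).le) (h0 k x))
      (fun k => ?_) (fun k => ?_)
    · obtain ⟨S, hSm, hSv, hS0⟩ := hS k
      exact ⟨S, hSm, hSv, fun x hx => by simp [hS0 x hx]⟩
    · have : ∀ x, ENNReal.ofReal ((c k)⁻¹ * g k x) ^ p =
          (N k)⁻¹ * ENNReal.ofReal (g k x) ^ p := by
        intro x
        rw [ENNReal.ofReal_mul (inv_nonneg.2 (hcpos k).le), ENNReal.ofReal_inv_of_pos (hcpos k),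
          hofc, ENNReal.mul_rpow_of_nonneg _ _ hp0.le, ENNReal.inv_rpow, ← ENNReal.rpow_mul,
          one_div, inv_mul_cancel₀ hp0.ne', ENNReal.rpow_one]
      simp only [this]
      rw [lintegral_const_mul' _ _ (ENNReal.inv_ne_top.2 (hz k)), ENNReal.inv_mul_cancel (hz k) (hNt k)]
  calc _ = sphereForm (fun k x => N k ^ (1 / p) * ENNReal.ofReal ((c k)⁻¹ * g k x)) := by
        simp only [hscale]
    _ = (∏ k, N k ^ (1 / p)) * sphereForm (fun k x => ENNReal.ofReal ((c k)⁻¹ * g k x)) :=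
        sphereForm_const_mul _ hNp _
    _ ≤ (∏ k, N k ^ (1 / p)) * C := by gcongr
    _ = _ := mul_comm _ _

/-- A continuous cutoff, equal to `1` on the ball of radius `2` and supported in that of radius
`3`. -/
def radialCutoff (x : 𝔼) : ℝ := max 0 (min 1 (3 - ‖x‖))

theorem radialCutoff_eq_one {x : 𝔼} (hx : ‖x‖ ≤ 2) : radialCutoff x = 1 := by
  unfold radialCutoff
  rw [min_eq_left (by linarith), max_eq_right zero_le_one]

theorem radialCutoff_eq_zero {x : 𝔼} (hx : 3 ≤ ‖x‖) : radialCutoff x = 0 := by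
  unfold radialCutoff
  rw [max_eq_left]
  exact (min_le_right _ _).trans (by linarith)

theorem radialCutoff_nonneg (x : 𝔼) : 0 ≤ radialCutoff x := le_max_left _ _

theorem radialCutoff_le_one (x : 𝔼) : radialCutoff x ≤ 1 :=
  max_le zero_le_one (min_le_left _ _)

theorem continuous_radialCutoff : Continuous (radialCutoff : 𝔼 → ℝ) := by
  unfold radialCutoff; fun_prop

/-- Hölder's inequality for the local `L^p` masses. -/
theorem lintegral_prod_setLIntegral_ball_le {p : ℝ} (hp0 : 0 < p) (hp2 : p ≤ n + 2)
    (G : Fin (n + 2) → 𝔼 → ℝ≥0∞) (hG : ∀ k, Measurable (G k)) :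
    ∫⁻ z, ∏ k, (∫⁻ x in Metric.ball z 3, G k x) ^ (1 / p) ≤
      volume (Metric.ball (0 : 𝔼) 3) * ∏ k, (∫⁻ x, G k x) ^ (1 / p) := by
  set v := volume (Metric.ball (0 : 𝔼) 3) with hv
  have hn0 : (0 : ℝ) < n + 2 := by positivity
  -- Hölder with n + 2 equal exponents raises each local mass to the power s. As s ≥ 1, one factor
  -- is integrated in z and the remaining power s - 1 is bounded by the global mass.
  set s : ℝ := (n + 2) / p with hs
  have hs1 : 1 ≤ s := by rw [hs, one_le_div hp0]; exact hp2
  have hind : ∀ k z, ∫⁻ x in Metric.ball z 3, G k x =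
      ∫⁻ x, (Metric.ball (0 : 𝔼) 3).indicator 1 (x - z) * G k x := by
    intro k z
    rw [← lintegral_indicator Metric.isOpen_ball.measurableSet]
    refine lintegral_congr fun x => ?_
    by_cases hx : x ∈ Metric.ball z 3
    · have : x - z ∈ Metric.ball (0 : 𝔼) 3 := by
        rwa [mem_ball_zero_iff, ← mem_ball_iff_norm]
      simp [hx, this]
    · have : x - z ∉ Metric.ball (0 : 𝔼) 3 := by
        rwa [mem_ball_zero_iff, ← mem_ball_iff_norm]
      simp only [Set.indicator_of_notMem hx, Set.indicator_of_notMem this, zero_mul]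
  have hone : Measurable ((Metric.ball (0 : 𝔼) 3).indicator (1 : 𝔼 → ℝ≥0∞)) :=
    measurable_one.indicator Metric.isOpen_ball.measurableSet
  have hjoint : ∀ k, Measurable fun q : 𝔼 × 𝔼 =>
      (Metric.ball (0 : 𝔼) 3).indicator (1 : 𝔼 → ℝ≥0∞) (q.2 - q.1) * G k q.2 := fun k =>
    (hone.comp (measurable_snd.sub measurable_fst)).mul ((hG k).comp measurable_snd)
  have hmeas : ∀ k, Measurable fun z => ∫⁻ x in Metric.ball z 3, G k x := fun k => by
    simp only [hind]
    exact (hjoint k).lintegral_prod_right'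
  have hmass : ∀ k, ∫⁻ z, ∫⁻ x in Metric.ball z 3, G k x = v * ∫⁻ x, G k x := by
    intro k
    simp only [hind]
    rw [lintegral_lintegral_swap (hjoint k).aemeasurable, ← lintegral_const_mul _ (hG k)]
    refine lintegral_congr fun x => ?_
    rw [lintegral_mul_const]
    · rw [lintegral_sub_left_eq_self (fun z => (Metric.ball (0 : 𝔼) 3).indicator 1 z) x,
        lintegral_indicator_one Metric.isOpen_ball.measurableSet]
    · exact hone.comp (measurable_const.sub measurable_id)
  have hpow : ∀ k, ∫⁻ z, (∫⁻ x in Metric.ball z 3, G k x) ^ s ≤ v * (∫⁻ x, G k x) ^ s := by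
    intro k
    have hsplit : ∀ t : ℝ≥0∞, t ^ s = t * t ^ (s - 1) := fun t => by
      nth_rewrite 2 [← ENNReal.rpow_one t]
      rw [← ENNReal.rpow_add_of_nonneg _ _ zero_le_one (by linarith)]
      congr 1; ring
    calc _ ≤ ∫⁻ z, (∫⁻ x in Metric.ball z 3, G k x) * (∫⁻ x, G k x) ^ (s - 1) := by
          refine lintegral_mono fun z => ?_
          rw [hsplit]
          gcongr
          exact Measure.restrict_le_self
      _ = v * (∫⁻ x, G k x) ^ s := by
          rw [lintegral_mul_const _ (hmeas k), hmass, hsplit, mul_assoc]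
  have hexp : s * (1 / ((n : ℝ) + 2)) = 1 / p := by rw [hs]; field_simp
  calc _ = ∫⁻ z, ∏ k, ((∫⁻ x in Metric.ball z 3, G k x) ^ s) ^ (1 / ((n : ℝ) + 2)) := by
        simp only [← ENNReal.rpow_mul, hexp]
    _ ≤ ∏ k, (∫⁻ z, (∫⁻ x in Metric.ball z 3, G k x) ^ s) ^ (1 / ((n : ℝ) + 2)) := by
        refine ENNReal.lintegral_prod_norm_pow_le Finset.univ
          (fun k _ => ((hmeas k).pow_const s).aemeasurable) ?_ fun k _ => by positivity
        rw [Finset.sum_const, Finset.card_univ, Fintype.card_fin, nsmul_eq_mul]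
        push_cast
        field_simp
    _ ≤ ∏ k, (v * (∫⁻ x, G k x) ^ s) ^ (1 / ((n : ℝ) + 2)) := by
        gcongr with k
        exact hpow k
    _ = _ := by
        simp only [ENNReal.mul_rpow_of_nonneg _ _ (by positivity : 0 ≤ 1 / ((n : ℝ) + 2)),
          Finset.prod_mul_distrib, ← ENNReal.rpow_mul, hexp]
        congr 1
        rw [Finset.prod_const, Finset.card_univ, Fintype.card_fin, ← ENNReal.rpow_natCast,
          ← ENNReal.rpow_mul]
        have : 1 / ((n : ℝ) + 2) * ((n + 2 : ℕ) : ℝ) = 1 := by push_cast; field_simp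
        rw [this, ENNReal.rpow_one]

/-- The strong-type estimate for the form on continuous compactly supported functions. -/
theorem exists_sphereForm_le (hd : 2 ≤ d) (hn : 1 ≤ n) {p : ℝ}
    (hp : ((d : ℝ) + 1) / d < p) (hp2 : p ≤ 2) :
    ∃ C : ℝ≥0∞, C ≠ ∞ ∧ ∀ g : Fin (n + 2) → 𝔼 → ℝ, (∀ k, Continuous (g k)) →
      (∀ k, HasCompactSupport (g k)) → (∀ k x, 0 ≤ g k x) →
      sphereForm (fun k x => ENNReal.ofReal (g k x)) ≤
        C * ∏ k, (∫⁻ x, ENNReal.ofReal (g k x) ^ p) ^ (1 / p) := by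
  set v := volume (Metric.ball (0 : 𝔼) 3) with hv
  have hvt : v ≠ ∞ := measure_ball_lt_top.ne
  set w := volume (Metric.ball (0 : 𝔼) 1) with hw
  have hwt : w ≠ ∞ := measure_ball_lt_top.ne
  have hw0 : w ≠ 0 := (Metric.measure_ball_pos _ _ one_pos).ne'
  have hp0 : 0 < p := lt_trans (by positivity) hp
  obtain ⟨C, hC, hmain⟩ := exists_sphereForm_local_le (n := n) hd hn hp hvt
  refine ⟨w⁻¹ * (C * v), ENNReal.mul_ne_top (ENNReal.inv_ne_top.2 hw0)
    (ENNReal.mul_ne_top hC hvt), fun g hg hc h0 => ?_⟩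
  set gz : 𝔼 → Fin (n + 2) → 𝔼 → ℝ := fun z k x => g k x * radialCutoff (x - z) with hgz
  have hcut : ∀ z : 𝔼, Continuous fun x : 𝔼 => radialCutoff (x - z) := fun z =>
    continuous_radialCutoff.comp (continuous_id.sub continuous_const)
  have hloc : ∀ z, sphereForm (fun k x => ENNReal.ofReal (gz z k x)) ≤
      C * ∏ k, (∫⁻ x in Metric.ball z 3, ENNReal.ofReal (g k x) ^ p) ^ (1 / p) := by
    intro z
    have hout : ∀ k x, x ∉ Metric.ball z 3 → gz z k x = 0 := by
      intro k x hx
      have : 3 ≤ ‖x - z‖ := by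
        rw [mem_ball_iff_norm, not_lt] at hx; exact hx
      simp only [hgz, radialCutoff_eq_zero this, mul_zero]
    refine (hmain (gz z) (fun k => (hg k).mul (hcut z)) (fun k => (hc k).mul_right)
      (fun k x => mul_nonneg (h0 k x) (radialCutoff_nonneg _)) fun k =>
        ⟨Metric.ball z 3, Metric.isOpen_ball.measurableSet, ?_, hout k⟩).trans ?_
    · rw [hv, Measure.addHaar_ball_center]
    · refine mul_le_mul' le_rfl (Finset.prod_le_prod' fun k _ =>
        ENNReal.rpow_le_rpow ?_ (by positivity))
      rw [← lintegral_indicator Metric.isOpen_ball.measurableSet]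
      refine lintegral_mono fun x => ?_
      by_cases hx : x ∈ Metric.ball z 3
      · rw [Set.indicator_of_mem hx]
        gcongr
        exact mul_le_of_le_one_right (h0 k x) (radialCutoff_le_one _)
      · simp [hout k x hx, hp0]
  set P : 𝔼 × 𝕎 → ℝ≥0∞ := fun q => ∏ k, ENNReal.ofReal (g k (formPoint k q)) with hP
  have hPm : Measurable P := Finset.measurable_prod _ fun k _ =>
    ((hg k).comp (continuous_formPoint k)).measurable.ennreal_ofReal
  have hone : Measurable ((Metric.ball (0 : 𝔼) 1).indicator (1 : 𝔼 → ℝ≥0∞)) :=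
    measurable_one.indicator Metric.isOpen_ball.measurableSet
  -- Average over centres z within distance 1 of x: all points x and x - u^j then lie within
  -- distance 2 of z, where the cutoff is 1.
  have havg : w * sphereForm (fun k x => ENNReal.ofReal (g k x)) ≤
      ∫⁻ z, sphereForm (fun k x => ENNReal.ofReal (gz z k x)) := by
    calc w * sphereForm (fun k x => ENNReal.ofReal (g k x))
        = ∫⁻ q, (∫⁻ z, (Metric.ball (0 : 𝔼) 1).indicator 1 (q.1 - z) * P q)
            ∂(volume.prod (unitSphereMeasure 𝕎)) := by
          unfold sphereForm
          rw [← lintegral_const_mul _ hPm]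
          refine lintegral_congr fun q => ?_
          rw [lintegral_mul_const]
          · rw [lintegral_sub_left_eq_self (fun z => (Metric.ball (0 : 𝔼) 1).indicator 1 z) q.1,
              lintegral_indicator_one Metric.isOpen_ball.measurableSet]
          · exact hone.comp (measurable_const.sub measurable_id)
      _ = ∫⁻ z, (∫⁻ q, (Metric.ball (0 : 𝔼) 1).indicator 1 (q.1 - z) * P q
            ∂(volume.prod (unitSphereMeasure 𝕎))) := by
          refine lintegral_lintegral_swap (Measurable.aemeasurable ?_)
          exact (hone.comp ((measurable_fst.comp measurable_fst).sub measurable_snd)).mul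
            (hPm.comp measurable_fst)
      _ ≤ _ := by
          refine lintegral_mono fun z => ?_
          unfold sphereForm
          have hae : ∀ᵐ q ∂((volume : Measure 𝔼).prod (unitSphereMeasure 𝕎)), ‖q.2‖ = 1 :=
            Measure.quasiMeasurePreserving_snd.ae ae_norm_eq_one
          refine lintegral_mono_ae ?_
          filter_upwards [hae] with q hq
          by_cases hx : q.1 - z ∈ Metric.ball (0 : 𝔼) 1
          · rw [Set.indicator_of_mem hx, Pi.one_apply, one_mul, hP]
            refine Finset.prod_le_prod' fun k _ => le_of_eq ?_
            simp only [hgz]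
            rw [radialCutoff_eq_one, mul_one]
            rw [mem_ball_zero_iff] at hx
            refine Fin.cases ?_ (fun j => ?_) k
            · rw [formPoint_zero]; linarith
            · rw [formPoint_succ, sub_right_comm]
              refine (norm_sub_le _ _).trans ?_
              have := norm_block_le j q.2
              linarith
          · rw [Set.indicator_of_notMem hx, zero_mul]
            exact zero_le
  have hfin : w * sphereForm (fun k x => ENNReal.ofReal (g k x)) ≤
      C * v * ∏ k, (∫⁻ x, ENNReal.ofReal (g k x) ^ p) ^ (1 / p) := by
    refine havg.trans ((lintegral_mono hloc).trans ?_)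
    rw [lintegral_const_mul' _ _ hC, mul_assoc]
    gcongr
    refine lintegral_prod_setLIntegral_ball_le hp0 ?_ (fun k x => ENNReal.ofReal (g k x) ^ p)
      fun k => (hg k).measurable.ennreal_ofReal.pow_const p
    -- The Hölder step needs p ≤ n + 2, which follows from p ≤ 2.
    have : (0 : ℝ) ≤ n := Nat.cast_nonneg n
    linarith
  calc _ = w⁻¹ * (w * sphereForm (fun k x => ENNReal.ofReal (g k x))) := by
        rw [← mul_assoc, ENNReal.inv_mul_cancel hw0 hwt, one_mul]
    _ ≤ w⁻¹ * (C * v * ∏ k, (∫⁻ x, ENNReal.ofReal (g k x) ^ p) ^ (1 / p)) := by gcongr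
    _ = _ := by ring

end StrongType

/-! ### Duality and passage to general L^p functions. -/

section Averages

open Filter Topology
open scoped ENNReal

variable {n d : ℕ}

local notation "𝔼" => EuclideanSpace ℝ (Fin d)
local notation "𝕎" => EuclideanSpace ℝ (Fin (n + 1) × Fin d)

theorem continuous_integral_prod_block {f : Fin (n + 1) → 𝔼 → ℝ} (hf : ∀ j, Continuous (f j))
    (hc : ∀ j, HasCompactSupport (f j)) :
    Continuous fun x => ∫ u : 𝕎, ∏ j, f j (x - block j u) ∂(unitSphereMeasure 𝕎) := by
  choose K hK using fun j => (hc j).exists_bound_of_continuous (hf j)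
  refine continuous_of_dominated (bound := fun _ => ∏ j, K j) (fun x => ?_) (fun x => ?_)
    (integrable_const _) (ae_of_all _ fun u => ?_)
  · refine Continuous.aestronglyMeasurable ?_
    exact continuous_finsetProd _ fun j _ =>
      (hf j).comp (continuous_const.sub (continuous_block j))
  · refine ae_of_all _ fun u => ?_
    rw [norm_prod]
    exact Finset.prod_le_prod (fun _ _ => norm_nonneg _) fun j _ => hK j _
  · exact continuous_finsetProd _ fun j _ => (hf j).comp (continuous_id.sub continuous_const)

theorem hasCompactSupport_integral_prod_block {f : Fin (n + 1) → 𝔼 → ℝ}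
    (hc : HasCompactSupport (f 0)) :
    HasCompactSupport fun x => ∫ u : 𝕎, ∏ j, f j (x - block j u) ∂(unitSphereMeasure 𝕎) := by
  obtain ⟨R, hR⟩ := hc.isBounded.subset_closedBall (0 : 𝔼)
  refine HasCompactSupport.intro (isCompact_closedBall (0 : 𝔼) (R + 1)) fun x hx => ?_
  rw [mem_closedBall_zero_iff, not_le] at hx
  refine integral_eq_zero_of_ae ?_
  filter_upwards [ae_norm_eq_one] with u hu
  refine Finset.prod_eq_zero (Finset.mem_univ 0) ?_
  refine image_eq_zero_of_notMem_tsupport fun h => ?_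
  have h1 := hR h
  rw [mem_closedBall_zero_iff] at h1
  have h2 := norm_block_le (0 : Fin (n + 1)) u
  have h3 := norm_le_norm_sub_add x (block 0 u)
  linarith

theorem ofReal_integral_prod_block {f : Fin (n + 1) → 𝔼 → ℝ} (hf : ∀ j, Continuous (f j))
    (hc : ∀ j, HasCompactSupport (f j)) (h0 : ∀ j x, 0 ≤ f j x) (x : 𝔼) :
    ENNReal.ofReal (∫ u : 𝕎, ∏ j, f j (x - block j u) ∂(unitSphereMeasure 𝕎)) =
      ∫⁻ u : 𝕎, ∏ j, ENNReal.ofReal (f j (x - block j u)) ∂(unitSphereMeasure 𝕎) := by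
  choose K hK using fun j => (hc j).exists_bound_of_continuous (hf j)
  rw [ofReal_integral_eq_lintegral_ofReal]
  · simp_rw [ENNReal.ofReal_prod_of_nonneg fun j _ => h0 j _]
  · refine integrable_unitSphere_of_continuous (C := ∏ j, K j) ?_ fun u _ => ?_
    · exact continuous_finsetProd _ fun j _ =>
        (hf j).comp (continuous_const.sub (continuous_block j))
    · rw [norm_prod]
      exact Finset.prod_le_prod (fun _ _ => norm_nonneg _) fun j _ => hK j _
  · exact ae_of_all _ fun u => Finset.prod_nonneg fun j _ => h0 j _

theorem sphereForm_cons {h : 𝔼 → ℝ≥0∞} {f : Fin (n + 1) → 𝔼 → ℝ≥0∞} (hh : Measurable h)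
    (hf : ∀ j, Measurable (f j)) :
    sphereForm (Fin.cons h f : Fin (n + 2) → 𝔼 → ℝ≥0∞) =
      ∫⁻ x, h x * ∫⁻ u : 𝕎, ∏ j, f j (x - block j u) ∂(unitSphereMeasure 𝕎) := by
  have hm : ∀ k, Measurable ((Fin.cons h f : Fin (n + 2) → 𝔼 → ℝ≥0∞) k) :=
    Fin.cases (by simpa using hh) (by simpa using hf)
  unfold sphereForm
  rw [lintegral_prod]
  · refine lintegral_congr fun x => ?_
    rw [← lintegral_const_mul]
    · refine lintegral_congr fun u => ?_
      rw [Fin.prod_univ_succ]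
      simp [formPoint_zero, formPoint_succ]
    · exact Finset.measurable_prod _ fun j _ =>
        (hf j).comp (continuous_const.sub (continuous_block j)).measurable
  · exact (Finset.measurable_prod _ fun k _ =>
      (hm k).comp (continuous_formPoint k).measurable).aemeasurable

/-- The strong type bound for averages of continuous functions of compact support. -/
theorem exists_lintegral_average_le (hd : 2 ≤ d) (hn : 1 ≤ n) {p q : ℝ}
    (hp : ((d : ℝ) + 1) / d < p) (hp2 : p ≤ 2) (hpq : p.HolderConjugate q) :
    ∃ C : ℝ≥0∞, C ≠ ∞ ∧ ∀ f : Fin (n + 1) → 𝔼 → ℝ, (∀ j, Continuous (f j)) →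
      (∀ j, HasCompactSupport (f j)) → (∀ j x, 0 ≤ f j x) →
      ∫⁻ x : 𝔼, (∫⁻ u : 𝕎, ∏ j, ENNReal.ofReal (f j (x - block j u))
          ∂(unitSphereMeasure 𝕎)) ^ q ≤
        (C * ∏ j, (∫⁻ x, ENNReal.ofReal (f j x) ^ p) ^ (1 / p)) ^ q := by
  obtain ⟨C, hC, H⟩ := exists_sphereForm_le hd hn hp hp2
  refine ⟨C, hC, fun f hf hc h0 => ?_⟩
  have hp0 := hpq.pos
  have hq0 := hpq.symm.pos
  have hq1 : 0 < q - 1 := hpq.symm.sub_one_pos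
  have hqp : (q - 1) * p = q := by
    have := hpq.symm.sub_one_mul_conj
    exact this
  set B : 𝔼 → ℝ := fun x => ∫ u : 𝕎, ∏ j, f j (x - block j u) ∂(unitSphereMeasure 𝕎) with hB
  have hB0 : ∀ x, 0 ≤ B x := fun x => integral_nonneg fun u => Finset.prod_nonneg fun j _ => h0 j _
  have hBc : Continuous B := continuous_integral_prod_block hf hc
  have hBs : HasCompactSupport B := hasCompactSupport_integral_prod_block (hc 0)
  have hBe : ∀ x, ∫⁻ u : 𝕎, ∏ j, ENNReal.ofReal (f j (x - block j u)) ∂(unitSphereMeasure 𝕎) =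
      ENNReal.ofReal (B x) := fun x => (ofReal_integral_prod_block hf hc h0 x).symm
  simp_rw [hBe]
  set Y : ℝ≥0∞ := ∫⁻ x, ENNReal.ofReal (B x) ^ q with hY
  set P : ℝ≥0∞ := ∏ j, (∫⁻ x, ENNReal.ofReal (f j x) ^ p) ^ (1 / p)
  have hBq : Continuous fun x => B x ^ q := hBc.rpow_const fun _ => Or.inr hq0.le
  have hBqs : HasCompactSupport fun x => B x ^ q :=
    hBs.comp_left (g := fun t : ℝ => t ^ q) (Real.zero_rpow hq0.ne')
  -- The dual function for B: since (q - 1) p = q, testing against it gives Y = ∫ B^q ≤ C Y^{1/p} P.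
  have hh : Continuous fun x => B x ^ (q - 1) := hBc.rpow_const fun _ => Or.inr hq1.le
  have hhs : HasCompactSupport fun x => B x ^ (q - 1) :=
    hBs.comp_left (g := fun t : ℝ => t ^ (q - 1)) (Real.zero_rpow hq1.ne')
  -- Known in advance because B is continuous with compact support; it allows division by Y^{1/p}.
  have hYt : Y ≠ ∞ := by
    have := (hBq.integrable_of_hasCompactSupport (μ := volume) hBqs).lintegral_lt_top
    simp_rw [← ENNReal.ofReal_rpow_of_nonneg (hB0 _) hq0.le] at this
    exact this.ne
  have hkey := H (Fin.cons (fun x => B x ^ (q - 1)) f) (Fin.cases (by simpa using hh) (by simpa using hf))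
    (Fin.cases (by simpa using hhs) (by simpa using hc))
    (Fin.cases (fun x => by simpa using Real.rpow_nonneg (hB0 x) _) (by simpa using h0))
  have hcons : (fun k x => ENNReal.ofReal
      ((Fin.cons (fun x => B x ^ (q - 1)) f : Fin (n + 2) → 𝔼 → ℝ) k x)) =
      (Fin.cons (fun x => ENNReal.ofReal (B x ^ (q - 1))) fun j x => ENNReal.ofReal (f j x) :
        Fin (n + 2) → 𝔼 → ℝ≥0∞) := by
    funext k
    refine Fin.cases ?_ (fun j => ?_) k <;> simp
  rw [hcons, sphereForm_cons hh.measurable.ennreal_ofReal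
    fun j => (hf j).measurable.ennreal_ofReal, Fin.prod_univ_succ] at hkey
  simp_rw [hBe] at hkey
  simp only [Fin.cons_zero, Fin.cons_succ] at hkey
  have e1 : ∫⁻ x, ENNReal.ofReal (B x ^ (q - 1)) * ENNReal.ofReal (B x) = Y := by
    refine lintegral_congr fun x => ?_
    rw [← ENNReal.ofReal_rpow_of_nonneg (hB0 x) hq1.le]
    nth_rewrite 2 [← ENNReal.rpow_one (ENNReal.ofReal (B x))]
    rw [← ENNReal.rpow_add_of_nonneg _ _ hq1.le zero_le_one, sub_add_cancel]
  have e2 : ∫⁻ x, ENNReal.ofReal (B x ^ (q - 1)) ^ p = Y := by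
    refine lintegral_congr fun x => ?_
    rw [← ENNReal.ofReal_rpow_of_nonneg (hB0 x) hq1.le, ← ENNReal.rpow_mul, hqp]
  rw [e1, e2] at hkey
  change Y ≤ C * (Y ^ (1 / p) * P) at hkey
  rcases eq_or_ne Y 0 with hY0 | hY0
  · rw [hY0]; exact zero_le
  have hs : Y = Y ^ (1 / p) * Y ^ (1 / q) := by
    rw [← ENNReal.rpow_add _ _ hY0 hYt, one_div, one_div, hpq.inv_add_inv_eq_one,
      ENNReal.rpow_one]
  have ha0 : Y ^ (1 / p) ≠ 0 := by simp [hY0, hYt]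
  have hat : Y ^ (1 / p) ≠ ∞ := ENNReal.rpow_ne_top_of_nonneg (by positivity) hYt
  have hfin : Y ^ (1 / q) ≤ C * P := by
    rw [← ENNReal.mul_le_mul_iff_right ha0 hat, ← hs]
    exact hkey.trans_eq (by ring)
  calc Y = (Y ^ (1 / q)) ^ q := by
        rw [← ENNReal.rpow_mul, one_div, inv_mul_cancel₀ hq0.ne', ENNReal.rpow_one]
    _ ≤ _ := ENNReal.rpow_le_rpow hfin hq0.le

/-- For fixed u the map is a translation. Hence null sets in ℝ^d pull back to null sets of pairs (x,
u), and almost-everywhere statements about f_j transfer to the integrand even though ν is singular.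
-/
theorem quasiMeasurePreserving_sub_block (j : Fin (n + 1)) :
    Measure.QuasiMeasurePreserving (fun z : 𝔼 × 𝕎 => z.1 - block j z.2)
      (volume.prod (unitSphereMeasure 𝕎)) volume := by
  refine QuasiMeasurePreserving.prod_of_left ?_ (ae_of_all _ fun u => ?_)
  · exact (continuous_fst.sub ((continuous_block j).comp continuous_snd)).measurable
  · exact (measurePreserving_sub_right volume (block j u)).quasiMeasurePreserving

/-- Density in L^p, then a subsequence converging almost everywhere; the bounds a k are the norm of
f plus the approximation error. -/
theorem exists_seq_compactSupport_tendsto {X F : Type*} [NormedAddCommGroup F] [NormedSpace ℝ F]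
    [TopologicalSpace X] [R1Space X] [WeaklyLocallyCompactSpace X] [NormalSpace X]
    [MeasurableSpace X] [BorelSpace X] [SecondCountableTopologyEither X F] {μ : Measure X}
    [μ.Regular] {p : ℝ≥0∞} (hp1 : 1 ≤ p)
    (hp : p ≠ ∞) {f : X → F} (hf : MemLp f p μ) :
    ∃ (g : ℕ → X → F) (a : ℕ → ℝ≥0∞), (∀ k, Continuous (g k)) ∧ (∀ k, HasCompactSupport (g k)) ∧
      (∀ k, eLpNorm (g k) p μ ≤ a k) ∧ Tendsto a atTop (𝓝 (eLpNorm f p μ)) ∧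
      ∀ᵐ x ∂μ, Tendsto (fun k => g k x) atTop (𝓝 (f x)) := by
  have hδ : ∀ k : ℕ, ((k : ℝ≥0∞) + 1)⁻¹ ≠ 0 := fun k => by
    simp
  choose g hgs hgd hgc hgm using fun k : ℕ => hf.exists_hasCompactSupport_eLpNorm_sub_le hp (hδ k)
  have hlim : Tendsto (fun k : ℕ => ((k : ℝ≥0∞) + 1)⁻¹) atTop (𝓝 0) := by
    have := (ENNReal.tendsto_inv_nat_nhds_zero).comp (tendsto_add_atTop_nat 1)
    simpa [Function.comp_def] using this
  have hgd' : ∀ k, eLpNorm (g k - f) p μ ≤ ((k : ℝ≥0∞) + 1)⁻¹ := fun k => by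
    rw [eLpNorm_sub_comm]; exact hgd k
  have hconv : Tendsto (fun k => eLpNorm (g k - f) p μ) atTop (𝓝 0) :=
    tendsto_of_tendsto_of_tendsto_of_le_of_le tendsto_const_nhds hlim (fun _ => zero_le) hgd'
  obtain ⟨s, hs, hae⟩ := (tendstoInMeasure_of_tendsto_eLpNorm (by positivity)
    (fun k => (hgm k).1) hf.1 hconv).exists_seq_tendsto_ae
  refine ⟨fun k => g (s k), fun k => eLpNorm f p μ + ((s k : ℝ≥0∞) + 1)⁻¹, fun k => hgc _,
    fun k => hgs _, fun k => ?_, ?_, hae⟩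
  · calc eLpNorm (g (s k)) p μ = eLpNorm (f + (g (s k) - f)) p μ := by rw [add_sub_cancel]
      _ ≤ _ := eLpNorm_add_le hf.1 ((hgm _).1.sub hf.1) hp1
      _ ≤ _ := add_le_add le_rfl (hgd' _)
  · simpa using tendsto_const_nhds.add (hlim.comp hs.tendsto_atTop)

theorem ennreal_liminf_rpow {q : ℝ} (hq : 0 < q) (u : ℕ → ℝ≥0∞) :
    liminf u atTop ^ q = liminf (fun k => u k ^ q) atTop :=
  OrderIso.liminf_apply (g := ENNReal.orderIsoRpow q hq) (f := atTop) (u := u)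

/-- The strong type bound for averages of the absolute values of `L^p` functions. -/
theorem exists_lintegral_average_enorm_le (hd : 2 ≤ d) (hn : 1 ≤ n) {p q : ℝ}
    (hp : ((d : ℝ) + 1) / d < p) (hp2 : p ≤ 2) (hpq : p.HolderConjugate q) :
    ∃ C : ℝ≥0∞, C ≠ ∞ ∧ ∀ f : Fin (n + 1) → 𝔼 → ℂ,
      (∀ j, MemLp (f j) (ENNReal.ofReal p) volume) →
      ∫⁻ x : 𝔼, (∫⁻ u : 𝕎, ∏ j, ‖f j (x - block j u)‖ₑ ∂(unitSphereMeasure 𝕎)) ^ q ≤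
        (C * ∏ j, eLpNorm (f j) (ENNReal.ofReal p) volume) ^ q := by
  obtain ⟨C, hC, H⟩ := exists_lintegral_average_le hd hn hp hp2 hpq
  refine ⟨C, hC, fun f hf => ?_⟩
  have hp0 := hpq.pos
  have hq0 := hpq.symm.pos
  choose g a hgc hgs hga ha hae using fun j =>
    exists_seq_compactSupport_tendsto (ENNReal.one_le_ofReal.2 hpq.lt.le) ENNReal.ofReal_ne_top
      (hf j)
  have hgm : ∀ k, Measurable fun z : 𝔼 × 𝕎 => ∏ j, ‖g j k (z.1 - block j z.2)‖ₑ := fun k =>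
    Finset.measurable_prod _ fun j _ => ((hgc j k).comp
      (continuous_fst.sub ((continuous_block j).comp continuous_snd))).enorm.measurable
  have hlim : ∀ᵐ x : 𝔼, ∀ᵐ u : 𝕎 ∂(unitSphereMeasure 𝕎),
      Tendsto (fun k => ∏ j, ‖g j k (x - block j u)‖ₑ) atTop
        (𝓝 (∏ j, ‖f j (x - block j u)‖ₑ)) := by
    have h1 : ∀ᵐ z : 𝔼 × 𝕎 ∂(volume.prod (unitSphereMeasure 𝕎)), ∀ j,
        Tendsto (fun k => g j k (z.1 - block j z.2)) atTop (𝓝 (f j (z.1 - block j z.2))) :=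
      ae_all_iff.2 fun j => (quasiMeasurePreserving_sub_block j).ae (hae j)
    filter_upwards [Measure.ae_ae_of_ae_prod h1] with x hx
    filter_upwards [hx] with u hu
    exact ENNReal.tendsto_finsetProd_of_ne_top _ (fun j _ => (hu j).enorm)
      fun j _ => enorm_ne_top
  -- Fatou's lemma in u for almost every x; a second application in x, at the end, passes to the
  -- limit in the bound for the approximants.
  have hfatou : ∀ᵐ x : 𝔼,
      (∫⁻ u : 𝕎, ∏ j, ‖f j (x - block j u)‖ₑ ∂(unitSphereMeasure 𝕎)) ^ q ≤
      liminf (fun k => (∫⁻ u : 𝕎, ∏ j, ‖g j k (x - block j u)‖ₑ ∂(unitSphereMeasure 𝕎)) ^ q)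
        atTop := by
    filter_upwards [hlim] with x hx
    have h1 : ∫⁻ u : 𝕎, ∏ j, ‖f j (x - block j u)‖ₑ ∂(unitSphereMeasure 𝕎) ≤
        liminf (fun k => ∫⁻ u : 𝕎, ∏ j, ‖g j k (x - block j u)‖ₑ ∂(unitSphereMeasure 𝕎))
          atTop := by
      have hm : ∀ k, Measurable fun u : 𝕎 => ∏ j, ‖g j k (x - block j u)‖ₑ := fun k =>
        (hgm k).of_uncurry_left (f := fun x u => ∏ j, ‖g j k (x - block j u)‖ₑ)
      refine le_trans (le_of_eq (lintegral_congr_ae ?_)) (lintegral_liminf_le hm)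
      filter_upwards [hx] with u hu using hu.liminf_eq.symm
    exact (ENNReal.rpow_le_rpow h1 hq0.le).trans_eq (ennreal_liminf_rpow hq0 _)
  have hbound : ∀ k, ∫⁻ x : 𝔼,
      (∫⁻ u : 𝕎, ∏ j, ‖g j k (x - block j u)‖ₑ ∂(unitSphereMeasure 𝕎)) ^ q ≤
      (C * ∏ j, a j k) ^ q := fun k => by
    have h1 := H (fun j x => ‖g j k x‖) (fun j => (hgc j k).norm) (fun j => (hgs j k).norm)
      fun j x => norm_nonneg _
    simp only [ofReal_norm] at h1
    refine h1.trans (ENNReal.rpow_le_rpow ?_ hq0.le)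
    refine mul_le_mul' le_rfl (Finset.prod_le_prod' fun j _ => ?_)
    refine le_trans (le_of_eq ?_) (hga j k)
    rw [eLpNorm_eq_lintegral_rpow_enorm_toReal (by simpa using hp0) ENNReal.ofReal_ne_top,
      ENNReal.toReal_ofReal hp0.le]
  have htend : Tendsto (fun k => (C * ∏ j, a j k) ^ q) atTop
      (𝓝 ((C * ∏ j, eLpNorm (f j) (ENNReal.ofReal p) volume) ^ q)) := by
    refine (ENNReal.continuous_rpow_const.tendsto _).comp ?_
    refine ENNReal.Tendsto.const_mul ?_ (Or.inr hC)
    exact ENNReal.tendsto_finsetProd_of_ne_top _ (fun j _ => ha j) fun j _ => (hf j).2.ne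
  calc _ ≤ ∫⁻ x : 𝔼, liminf (fun k =>
          (∫⁻ u : 𝕎, ∏ j, ‖g j k (x - block j u)‖ₑ ∂(unitSphereMeasure 𝕎)) ^ q) atTop :=
        lintegral_mono_ae hfatou
    _ ≤ liminf (fun k => ∫⁻ x : 𝔼,
          (∫⁻ u : 𝕎, ∏ j, ‖g j k (x - block j u)‖ₑ ∂(unitSphereMeasure 𝕎)) ^ q) atTop :=
        lintegral_liminf_le fun k => (hgm k).lintegral_prod_right'.pow_const q
    _ ≤ liminf (fun k => (C * ∏ j, a j k) ^ q) atTop :=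
        liminf_le_liminf (Eventually.of_forall hbound)
    _ = _ := htend.liminf_eq

theorem aestronglyMeasurable_prod_block {f : Fin (n + 1) → 𝔼 → ℂ}
    (hf : ∀ j, AEStronglyMeasurable (f j) volume) :
    AEStronglyMeasurable (fun z : 𝔼 × 𝕎 => ∏ j, f j (z.1 - block j z.2))
      (volume.prod (unitSphereMeasure 𝕎)) :=
  Finset.aestronglyMeasurable_fun_prod _ fun j _ =>
    (hf j).comp_quasiMeasurePreserving (quasiMeasurePreserving_sub_block j)

end Averages

end

/-! ### The theorem for complex L^p functions. -/

theorem corollary2p5 (m d : ℕ) (hm : 2 ≤ m) (hd : 1 ≤ d) (p q : ℝ)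
    (hp : ((d : ℝ) + 1) / (d : ℝ) < p) (hp2 : p ≤ 2) (hpq : p.HolderConjugate q) :
    ∃ C : NNReal, ∀ f : Fin m → EuclideanSpace ℝ (Fin d) → ℂ,
      (∀ j, MemLp (f j) (ENNReal.ofReal p) volume) →
        (∀ᵐ x : EuclideanSpace ℝ (Fin d),
          Integrable (fun u => ∏ j, f j (x - block j u)) (sphereSurfaceMeasure m d)) ∧
        MemLp (multilinearAverage (sphereSurfaceMeasure m d) f) (ENNReal.ofReal q) volume ∧
        eLpNorm (multilinearAverage (sphereSurfaceMeasure m d) f) (ENNReal.ofReal q) volume ≤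
          (C : ENNReal) * ∏ j, eLpNorm (f j) (ENNReal.ofReal p) volume := by
  obtain ⟨n, rfl⟩ : ∃ n, m = n + 1 := ⟨m - 1, by omega⟩
  -- For d = 1 the range of p would be 2 < p ≤ 2, which is empty.
  have hd2 : 2 ≤ d := by
    by_contra h
    obtain rfl : d = 1 := by omega
    norm_num at hp
    linarith
  have hq0 := hpq.symm.pos
  obtain ⟨C, hC, H⟩ := exists_lintegral_average_enorm_le (n := n) hd2 (by omega) hp hp2 hpq
  refine ⟨C.toNNReal, fun f hf => ?_⟩
  rw [ENNReal.coe_toNNReal hC]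
  have hν : sphereSurfaceMeasure (n + 1) d =
    unitSphereMeasure (EuclideanSpace ℝ (Fin (n + 1) × Fin d)) := rfl
  rw [hν]
  have hmeas := aestronglyMeasurable_prod_block fun j => (hf j).1
  have hfin : C * ∏ j, eLpNorm (f j) (ENNReal.ofReal p) volume ≠ ⊤ :=
    ENNReal.mul_ne_top hC (ENNReal.prod_ne_top fun j _ => (hf j).2.ne)
  have hle := H f hf
  have hbd : eLpNorm (multilinearAverage
      (unitSphereMeasure (EuclideanSpace ℝ (Fin (n + 1) × Fin d))) f) (ENNReal.ofReal q) volume ≤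
      C * ∏ j, eLpNorm (f j) (ENNReal.ofReal p) volume := by
    rw [eLpNorm_eq_lintegral_rpow_enorm_toReal (by simpa using hq0) ENNReal.ofReal_ne_top,
      ENNReal.toReal_ofReal hq0.le, one_div, ENNReal.rpow_inv_le_iff hq0]
    refine (lintegral_mono fun x => ENNReal.rpow_le_rpow ?_ hq0.le).trans hle
    refine (enorm_integral_le_lintegral_enorm _).trans_eq (lintegral_congr fun u => ?_)
    simp only [← ofReal_norm, norm_prod, ENNReal.ofReal_prod_of_nonneg fun _ _ => norm_nonneg _]
  refine ⟨?_, ⟨hmeas.integral_prod_right', hbd.trans_lt hfin.lt_top⟩, hbd⟩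
  -- Finiteness of the L^q norm of the average of absolute values makes that average finite for
  -- almost every x, which is absolute convergence.
  have hlt := ae_lt_top' (hmeas.enorm.lintegral_prod_right'.pow_const q) (ne_top_of_le_ne_top
    (ENNReal.rpow_ne_top_of_nonneg hq0.le hfin) (le_trans (le_of_eq (lintegral_congr fun x => by
      simp only [← ofReal_norm, norm_prod,
        ENNReal.ofReal_prod_of_nonneg fun _ _ => norm_nonneg _])) hle))
  filter_upwards [hlt, hmeas.prodMk_left] with x hx hxm
  exact ⟨hxm, by simpa [HasFiniteIntegral, ENNReal.rpow_lt_top_iff_of_pos hq0] using hx⟩
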